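/- For each number of tests $m\ge 1$ let $(\nu_1,X_1),\dots,(\nu_m,X_m)$ be i.i.d. with $P(\nu_i=1)=p_m=1-P(\nu_i=0)$, $p_m\in(0,1)$, where $X_i\sim N(0,\sigma_m^2)$ given $\nu_i=0$ (the null hypothesis $H_{0i}$) and $X_i\sim N(0,\sigma_m^2+\tau_m^2)$ given $\nu_i=1$ (the alternative), with $\sigma_m^2,\tau_m^2>0$. A type I error costs $\delta_{0,m}>0$ and a type II error costs $\delta_{A,m}>0$; the Bayes risk of a multiple testing rule is $$R=\sum_{i=1}^m\big\{(1-p_m)\,t_{1i}\,\delta_{0,m}+p_m\,t_{2i}\,\delta_{A,m}\big\},$$ where $t_{1i}=P(H_{0i}\text{ is rejected}\mid \nu_i=0)$ and $t_{2i}=P(H_{0i}\text{ is accepted}\mid \nu_i=1)$. Put $\delta_m=\delta_{0,m}/\delta_{A,m}$, $u_m=\tau_m^2/\sigma_m^2$, $f_m=(1-p_m)/p_m$ and $v_m=u_mf_m^2\delta_m^2$. The Bayes oracle rejects $H_{0i}$ if and only if $\phi_A(X_i)/\phi_0(X_i)\ge f_m\delta_m$, where $\phi_0,\phi_A$ are the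 densities of $X_i$ given $\nu_i=0$ and $\nu_i=1$; $R_{opt}$ denotes its Bayes risk. A rule is called asymptotically optimal if $R/R_{opt}\to1$ as $m\to\infty$. The Benjamini–Hochberg (BH) rule at FDR level $\alpha$ uses the p-values $2\big(1-\Phi(|X_i|/\sigma_m)\big)$, sorted as $p_{(1)}\le\dots\le p_{(m)}$; it rejects all hypotheses with p-value at most $p_{(k)}$, where $k$ is the largest index with $p_{(k)}\le k\alpha/m$, and rejects nothing if there is no such $k$. **Corollary.** Suppose that for some constants $a_1,a_2\in(0,\infty)$ and $a_3\in(0,1)$ $$a_1m^{-1}\le p_m\le a_2m^{-a_3}\qquad\text{for all } m\ge1,$$ and that the signals are on the verge of detectability, in at least one of the following two senses: (a) $u_m\to\infty$, $v_m\to\infty$ and $\log v_m/u_m\to C$ for some $C\in(0,\infty)$; (b) $u_m/\log m\to C_u$ for some $C_u\in(0,\infty)$. Then for every fixed $\alpha\in(0,1)$ the BH rule at FDR level $\alpha$ is asymptotically optimal if and only if $$\delta_m\to0\qquad\text{and}\qquad\frac{\log\delta_m}{\log m}\to0 .$$ -/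

import Mathlib

open Filter Topology MeasureTheory ProbabilityTheory
open scoped NNReal ENNReal

namespace ScaleMixture

/-- The parameter vector `(p, τ², σ², δ₀, δ_A)` of the two-group normal scale mixture model with
additive losses: a null observation is `N(0, σ²)`, a non-null one is `N(0, σ² + τ²)`, a hypothesis
is non-null with probability `p`; a type I error costs `δ₀`, a type II error costs `δ_A`. -/
structure Params where
  p : ℝ
  tauSq : ℝ≥0
  sigmaSq : ℝ≥0
  delta0 : ℝ
  deltaA : ℝ
  p_pos : 0 < p
  p_lt_one : p < 1
  tauSq_pos : 0 < tauSq
  sigmaSq_pos : 0 < sigmaSq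
  delta0_pos : 0 < delta0
  deltaA_pos : 0 < deltaA

namespace Params

/-- The ratio of losses `δ = δ₀ / δ_A`. -/
noncomputable def delta (θ : Params) : ℝ := θ.delta0 / θ.deltaA

/-- The signal magnitude `u = (τ / σ)²`. -/
noncomputable def u (θ : Params) : ℝ := (θ.tauSq : ℝ) / (θ.sigmaSq : ℝ)

/-- The odds of the null hypothesis, `f = (1 - p) / p`. -/
noncomputable def f (θ : Params) : ℝ := (1 - θ.p) / θ.p

/-- The parameter `v = u f² δ²`. -/
noncomputable def v (θ : Params) : ℝ := θ.u * θ.f ^ 2 * θ.delta ^ 2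

/-- The joint law of one pair `(ν, X)`: `ν` is `true` (the alternative holds) with probability `p`,
and given `ν` the observation `X` is `N(0, σ²)` if `ν = false`, `N(0, σ² + τ²)` if `ν = true`. -/
noncomputable def pairLaw (θ : Params) : Measure (Bool × ℝ) :=
  ENNReal.ofReal (1 - θ.p) • (Measure.dirac false).prod (gaussianReal 0 θ.sigmaSq)
    + ENNReal.ofReal θ.p • (Measure.dirac true).prod (gaussianReal 0 (θ.sigmaSq + θ.tauSq))

instance (θ : Params) : IsProbabilityMeasure θ.pairLaw := by
  constructor
  have h1 : 0 ≤ 1 - θ.p := by linarith [θ.p_lt_one]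
  simp only [pairLaw, Measure.add_apply, Measure.smul_apply, measure_univ, smul_eq_mul, mul_one]
  rw [← ENNReal.ofReal_add h1 θ.p_pos.le]
  simp

/-- The joint law of `m` independent pairs `(ν_i, X_i)`. -/
noncomputable def dataLaw (θ : Params) (m : ℕ) : Measure (Fin m → Bool × ℝ) :=
  Measure.pi fun _ => θ.pairLaw

end Params

/-- A multiple testing rule for `m` hypotheses: it maps the observations to the set of the indices
of the rejected null hypotheses. -/
abbrev Rule (m : ℕ) : Type := (Fin m → ℝ) → Set (Fin m)

/-- The event that the rule `d` rejects the `i`-th null hypothesis. -/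
def rejectEvent {m : ℕ} (d : Rule m) (i : Fin m) : Set (Fin m → Bool × ℝ) :=
  {ω | i ∈ d (fun j => (ω j).2)}

/-- The probability of a type I error in the `i`-th test: the conditional probability that the
`i`-th null hypothesis is rejected, given that it is true. -/
noncomputable def typeIError (θ : Params) {m : ℕ} (d : Rule m) (i : Fin m) : ℝ :=
  (ProbabilityTheory.cond (θ.dataLaw m) {ω | (ω i).1 = false}).real (rejectEvent d i)

/-- The probability of a type II error in the `i`-th test: the conditional probability that the
`i`-th null hypothesis is accepted, given that it is false. -/
noncomputable def typeIIError (θ : Params) {m : ℕ} (d : Rule m) (i : Fin m) : ℝ :=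
  (ProbabilityTheory.cond (θ.dataLaw m) {ω | (ω i).1 = true}).real (rejectEvent d i)ᶜ

/-- The Bayes risk of a multiple testing rule under the additive loss. -/
noncomputable def risk (θ : Params) {m : ℕ} (d : Rule m) : ℝ :=
  ∑ i : Fin m, ((1 - θ.p) * typeIError θ d i * θ.delta0 + θ.p * typeIIError θ d i * θ.deltaA)

/-- The Bayes oracle: reject the `i`-th null hypothesis if and only if
`φ_A(X_i) / φ_0(X_i) ≥ (1 - p) δ₀ / (p δ_A)`, where `φ_A` and `φ_0` are the densities of an
observation under the alternative and under the null hypothesis. -/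
noncomputable def bayesOracle (θ : Params) (m : ℕ) : Rule m := fun x =>
  {i | (1 - θ.p) * θ.delta0 / (θ.p * θ.deltaA) ≤
    gaussianPDFReal 0 (θ.sigmaSq + θ.tauSq) (x i) / gaussianPDFReal 0 θ.sigmaSq (x i)}

/-- The standard normal distribution function `Φ`. -/
noncomputable def stdNormalCDF (x : ℝ) : ℝ := ProbabilityTheory.cdf (gaussianReal 0 1) x

/-- The two-sided p-value `2 (1 - Φ(|X_i| / σ))`. -/
noncomputable def pValue (θ : Params) {m : ℕ} (x : Fin m → ℝ) (i : Fin m) : ℝ :=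
  2 * (1 - stdNormalCDF (|x i| / Real.sqrt θ.sigmaSq))

/-- The p-values in ascending order; the entry with (zero-based) index `j` is the order statistic
`p_(j+1)`. -/
noncomputable def sortedPValue (θ : Params) {m : ℕ} (x : Fin m → ℝ) (j : Fin m) : ℝ :=
  pValue θ x (Tuple.sort (pValue θ x) j)

/-- The (zero-based) indices `j` with `p_(j+1) ≤ (j + 1) α / m`. -/
noncomputable def bhIndices (θ : Params) (α : ℝ) {m : ℕ} (x : Fin m → ℝ) : Finset (Fin m) :=
  Finset.univ.filter fun j => sortedPValue θ x j ≤ ((j : ℕ) + 1 : ℝ) * α / m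

/-- The Benjamini-Hochberg rule at FDR level `α`: with `k` the largest index such that
`p_(k) ≤ k α / m`, reject all hypotheses whose p-value is at most `p_(k)`; if there is no such `k`,
reject nothing. -/
noncomputable def benjaminiHochberg (θ : Params) (α : ℝ) (m : ℕ) : Rule m := fun x =>
  {i | ∃ h : (bhIndices θ α x).Nonempty, pValue θ x i ≤ sortedPValue θ x ((bhIndices θ α x).max' h)}

/-- A sequence of rules (the `m`-th one for `m` tests, under the parameters `γ m`) is asymptotically
optimal if the ratio of its Bayes risk to the Bayes risk of the Bayes oracle tends to one. -/
def AsymptoticallyOptimal (γ : ℕ → Params) (d : (m : ℕ) → Rule m) : Prop :=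
  Tendsto (fun m => risk (γ m) (d m) / risk (γ m) (bayesOracle (γ m) m)) atTop (𝓝 1)

/-- The sequence `γ` lies in the detectable region with constant `C`: `0 ≤ C < ∞`, `u → ∞`, `v → ∞`
and `log v / u → C`. -/
def Detectable (γ : ℕ → Params) (C : ℝ) : Prop :=
  0 ≤ C ∧ Tendsto (fun m => (γ m).u) atTop atTop ∧ Tendsto (fun m => (γ m).v) atTop atTop ∧
    Tendsto (fun m => Real.log (γ m).v / (γ m).u) atTop (𝓝 C)

/-- Signals on the verge of detectability: the detectable region with a constant `C ∈ (0, ∞)`. -/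
def VergeOfDetectability (γ : ℕ → Params) : Prop := ∃ C : ℝ, 0 < C ∧ Detectable γ C

/-- The explicit form of the verge of detectability: `u_m / log m → C_u ∈ (0, ∞)`. -/
def LogarithmicSignals (γ : ℕ → Params) : Prop :=
  ∃ Cu : ℝ, 0 < Cu ∧ Tendsto (fun m : ℕ => (γ m).u / Real.log m) atTop (𝓝 Cu)

end ScaleMixture

/-! Divide the risk by `m p δ_A`, so that each test contributes `f δ t₁ + t₂` and rejecting nothing
costs 1. If `-log p / log m → L` and `u / log m → w`, cutting at `X² / σ² ≥ κ log m` has type II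
error tending to `limitMiss w κ`, which is continuous and strictly increasing in `κ ≥ 0`. A factor
`m^{o(1)}` in a p-value threshold is therefore invisible in the limit.

The BH rule does not know `δ`. Its p-value threshold is `p` up to factors `m^{o(1)}`, which is `κ =
2L`, and its type I error is of exact order `p`. Since `f p → 1`, its normalized risk is `limitMiss
w (2L) + o(1)` plus a term of exact order `δ`. Two Chernoff arguments carry this:
`exists_mem_rejectEvent_bound` against too many rejections, `exists_rejection_number` against too
few.

The oracle cuts near `X² / σ² = 2 log (f δ)`, which is `κ = 2L` again when `log δ / log m → 0`; if
also `δ → 0`, both risks have the same positive limit. Conversely, if `δ` stays away from zero, BH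
pays an extra multiple of `δ` (`not_optimal_of_le_delta`); if `log δ ≤ -ε log m`, a fixed cut below
that of BH has vanishing type I cost and strictly smaller type II error
(`not_optimal_of_log_delta_le`).

The ratios need not converge along all `m`. The argument runs along ultrafilters, where compactness
supplies `L` and the negation of an eventual property is itself eventual. -/

namespace ScaleMixture

/-! ### Tails of the standard normal law -/

/-- The two-sided tail probability `P(|Z| ≥ c)` of a standard normal variable `Z`. -/
noncomputable def normalTail (c : ℝ) : ℝ := (gaussianReal 0 1).real {z | c ≤ |z|}

theorem normalTail_nonneg (c : ℝ) : 0 ≤ normalTail c := measureReal_nonneg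

theorem normalTail_zero : normalTail 0 = 1 := by
  simp [normalTail]

theorem normalTail_antitone : Antitone normalTail := fun _ _ h =>
  measureReal_mono fun _ hz => h.trans hz

theorem normalTail_eq_integral {c : ℝ} (hc : 0 ≤ c) :
    normalTail c = 1 - ∫ x in -c..c, gaussianPDFReal 0 1 x := by
  have hset : {z : ℝ | c ≤ |z|} = (Set.Ioo (-c) c)ᶜ := by
    ext z; simp only [Set.mem_ofPred_eq, Set.mem_compl_iff, Set.mem_Ioo, ← abs_lt, not_lt]
  rw [normalTail, hset, probReal_compl_eq_one_sub measurableSet_Ioo,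
    intervalIntegral.integral_of_le (by linarith), measureReal_def,
    gaussianReal_apply_eq_integral 0 one_ne_zero, ENNReal.toReal_ofReal, integral_Ioc_eq_integral_Ioo]
  exact integral_nonneg fun x => gaussianPDFReal_nonneg 0 1 x

theorem intervalIntegrable_gaussianPDFReal (a b : ℝ) :
    IntervalIntegrable (gaussianPDFReal 0 1) volume a b :=
  (integrable_gaussianPDFReal 0 1).intervalIntegrable

theorem continuousOn_normalTail : ContinuousOn normalTail (Set.Ici 0) := by
  have hp := intervalIntegral.continuous_primitive intervalIntegrable_gaussianPDFReal 0
  have : ContinuousOn (fun c : ℝ => 1 - ((∫ x in (0 : ℝ)..c, gaussianPDFReal 0 1 x) -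
      ∫ x in (0 : ℝ)..(-c), gaussianPDFReal 0 1 x)) (Set.Ici 0) :=
    (continuous_const.sub (hp.sub (hp.comp continuous_neg))).continuousOn
  refine this.congr fun c hc => ?_
  rw [normalTail_eq_integral hc]
  beta_reduce
  rw [intervalIntegral.integral_interval_sub_left] <;>
    exact intervalIntegrable_gaussianPDFReal _ _

theorem normalTail_strictAntiOn : StrictAntiOn normalTail (Set.Ici 0) := by
  intro a ha b hb hab
  have hpos : 0 < (gaussianReal 0 1).real (Set.Ioo a b) := by
    rw [measureReal_def, ENNReal.toReal_pos_iff]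
    refine ⟨?_, measure_lt_top _ _⟩
    rw [pos_iff_ne_zero]
    intro h0
    have := gaussianReal_absolutelyContinuous' 0 one_ne_zero h0
    simp at this
    linarith
  have hle : normalTail b + (gaussianReal 0 1).real (Set.Ioo a b) ≤ normalTail a := by
    rw [normalTail, normalTail, ← measureReal_union _ measurableSet_Ioo]
    · refine measureReal_mono ?_
      rintro z (hz | hz)
      · exact hab.le.trans hz
      · exact hz.1.le.trans (le_abs_self z)
    · rw [Set.disjoint_left]
      rintro z hz ⟨h1, h2⟩
      rw [Set.mem_ofPred_eq, abs_of_nonneg (le_trans ha h1.le)] at hz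
      linarith
  linarith

theorem normalTail_pos (c : ℝ) : 0 < normalTail c := by
  have h0 : (0 : ℝ) ≤ max c 0 := le_max_right _ _
  have := normalTail_strictAntiOn (a := max c 0) h0 (b := max c 0 + 1)
    (show (0 : ℝ) ≤ _ by linarith) (by linarith)
  exact (normalTail_nonneg _).trans_lt (this.trans_le (normalTail_antitone (le_max_left _ _)))

theorem normalTail_lt_one {c : ℝ} (hc : 0 < c) : normalTail c < 1 := by
  rw [← normalTail_zero]
  exact normalTail_strictAntiOn (Set.self_mem_Ici) hc.le hc

theorem gaussianReal_Ici_eq_Iic_neg (c : ℝ) :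
    (gaussianReal 0 1).real (Set.Ici c) = (gaussianReal 0 1).real (Set.Iic (-c)) := by
  have h := gaussianReal_map_neg (μ := 0) (v := 1)
  rw [neg_zero] at h
  conv_lhs => rw [← h]
  rw [map_measureReal_apply measurable_neg measurableSet_Ici]
  congr 1; ext x; simp

theorem normalTail_eq_two_mul {c : ℝ} (hc : 0 ≤ c) :
    normalTail c = 2 * (gaussianReal 0 1).real (Set.Ici c) := by
  have : NullSingletonClass (gaussianReal 0 1) := nullSingletonClass_gaussianReal one_ne_zero
  have hset : {z : ℝ | c ≤ |z|} = Set.Ici c ∪ Set.Iic (-c) := by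
    ext z; simp [le_abs, le_neg]
  have hz : gaussianReal 0 1 (Set.Ici c ∩ Set.Iic (-c)) = 0 := by
    refine measure_mono_null (t := {c}) ?_ (measure_singleton c)
    rintro z ⟨h1, h2⟩
    simp only [Set.mem_Ici, Set.mem_Iic] at h1 h2
    simp only [Set.mem_singleton_iff]; linarith
  have := measureReal_union_add_inter (μ := gaussianReal 0 1) (s := Set.Ici c)
    (measurableSet_Iic (a := -c))
  rw [measureReal_def (gaussianReal 0 1) (Set.Ici c ∩ Set.Iic (-c)), hz] at this
  rw [normalTail, hset]
  rw [gaussianReal_Ici_eq_Iic_neg c] at this ⊢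
  simpa [two_mul] using this

theorem two_mul_one_sub_stdNormalCDF {c : ℝ} (hc : 0 ≤ c) :
    2 * (1 - stdNormalCDF c) = normalTail c := by
  have : NullSingletonClass (gaussianReal 0 1) := nullSingletonClass_gaussianReal one_ne_zero
  rw [normalTail_eq_two_mul hc, stdNormalCDF, cdf_eq_real,
    ← probReal_compl_eq_one_sub measurableSet_Iic, Set.compl_Iic, measureReal_def, measureReal_def,
    measure_congr Ioi_ae_eq_Ici]

theorem normalTail_le_exp {c : ℝ} (hc : 0 ≤ c) : normalTail c ≤ 2 * Real.exp (-c ^ 2 / 2) := by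
  have h := measure_ge_le_exp_mul_mgf (μ := gaussianReal 0 1) (X := id) c hc
    (integrable_exp_mul_gaussianReal c)
  rw [mgf_id_gaussianReal, ← Real.exp_add] at h
  rw [normalTail_eq_two_mul hc]
  have h2 : -c * c + (0 * c + ((1 : ℝ≥0) : ℝ) * c ^ 2 / 2) = -c ^ 2 / 2 := by push_cast; ring
  rw [h2] at h
  have : {ω : ℝ | c ≤ id ω} = Set.Ici c := rfl
  rw [this] at h
  linarith

/-- On `[c, c + 1]` the density is at least its value at `c + 1`. The loss against the upper tail
bound is only `exp (O(c + 1))`, negligible when `c²` is of order `log m`. -/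
theorem exp_le_normalTail {c : ℝ} (hc : 0 ≤ c) :
    (√(2 * Real.pi))⁻¹ * Real.exp (-(c + 1) ^ 2 / 2) ≤ normalTail c := by
  have hsub : (gaussianReal 0 1).real (Set.Icc c (c + 1)) ≤ normalTail c :=
    measureReal_mono fun z hz => hz.1.trans (le_abs_self z)
  refine le_trans ?_ hsub
  rw [measureReal_def, gaussianReal_apply_eq_integral 0 one_ne_zero, ENNReal.toReal_ofReal
    (integral_nonneg fun x => gaussianPDFReal_nonneg 0 1 x)]
  have h := setIntegral_mono_on (μ := volume) (s := Set.Icc c (c + 1))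
    (f := fun _ => (√(2 * Real.pi))⁻¹ * Real.exp (-(c + 1) ^ 2 / 2)) (g := gaussianPDFReal 0 1)
    (integrableOn_const (by simp)) (integrable_gaussianPDFReal 0 1).integrableOn
    measurableSet_Icc (fun x hx => by
      simp only [gaussianPDFReal, NNReal.coe_one, mul_one, sub_zero]
      gcongr
      · linarith [hx.1]
      · exact hx.2)
  simpa using h

theorem exists_normalTail_eq {t : ℝ} (h0 : 0 < t) (h1 : t ≤ 1) : ∃ c, 0 ≤ c ∧ normalTail c = t := by
  set b : ℝ := 2 * Real.log (2 / t)
  have hlog : 0 ≤ Real.log (2 / t) := Real.log_nonneg (by rw [le_div_iff₀ h0]; linarith)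
  have hb : normalTail (√b) ≤ t := by
    refine (normalTail_le_exp (Real.sqrt_nonneg b)).trans ?_
    rw [Real.sq_sqrt (by positivity)]
    have : -b / 2 = -Real.log (2 / t) := by simp only [b]; ring
    rw [this, Real.exp_neg, Real.exp_log (by positivity)]
    field_simp; rfl
  have := intermediate_value_Icc' (Real.sqrt_nonneg b)
    (continuousOn_normalTail.mono fun x hx => hx.1)
  obtain ⟨c, hc, rfl⟩ := this ⟨hb, by rw [normalTail_zero]; exact h1⟩
  exact ⟨c, hc.1, rfl⟩

theorem normalTail_le_iff {a b : ℝ} (ha : 0 ≤ a) (hb : 0 ≤ b) :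
    normalTail a ≤ normalTail b ↔ b ≤ a :=
  normalTail_strictAntiOn.le_iff_ge ha hb

theorem gaussianReal_abs_ge {v : ℝ≥0} (hv : v ≠ 0) (c : ℝ) :
    (gaussianReal 0 v).real {x | c * √v ≤ |x|} = normalTail c := by
  have hs : 0 < √(v : ℝ) := Real.sqrt_pos.2 (by positivity)
  have h := gaussianReal_map_const_mul (μ := 0) (v := 1) (√(v : ℝ))
  have hv' : NNReal.mk (√(v : ℝ) ^ 2) (sq_nonneg _) * 1 = v := by
    ext; simp
  rw [hv', mul_zero] at h
  have hm : MeasurableSet {x : ℝ | c * √v ≤ |x|} :=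
    measurableSet_le measurable_const measurable_id.abs
  rw [← h, map_measureReal_apply (by fun_prop) hm, normalTail]
  congr 1; ext x
  simp only [Set.preimage_ofPred_eq, Set.mem_ofPred_eq, abs_mul, abs_of_pos hs]
  rw [mul_comm, mul_le_mul_iff_right₀ hs]

/-! ### Chernoff bound for counts of independent coordinates -/

open Classical in
/-- A Chernoff bound for the number of coordinates, other than the `i`-th one, that fall into `B`,
on the event that the `i`-th coordinate falls into `A`. -/
theorem pi_real_count_le {ι Ω : Type*} [Fintype ι] [MeasurableSpace Ω] (ρ : Measure Ω)
    [IsProbabilityMeasure ρ] {A B : Set Ω} (hA : MeasurableSet A) (hB : MeasurableSet B) (i : ι)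
    (lam k : ℝ) :
    (Measure.pi fun _ : ι => ρ).real
        {ω | ω i ∈ A ∧ lam * k ≤ lam * (Finset.univ.filter fun j => j ≠ i ∧ ω j ∈ B).card} ≤
      Real.exp (-(lam * k)) * ρ.real A *
        Real.exp ((Fintype.card ι - 1 : ℝ) * ρ.real B * (Real.exp lam - 1)) := by
  -- The product of the `g j` is the indicator of `A` at `i` times `exp (lam * count)`. Markov's
  -- inequality and independence then give the bound, for `lam` of either sign.
  set g : ι → Ω → ℝ := fun j => if j = i then A.indicator 1
    else fun x => 1 + B.indicator (fun _ => Real.exp lam - 1) x with hg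
  have hgi : g i = A.indicator 1 := by simp [hg]
  have hgj : ∀ j, j ≠ i → g j = fun x => 1 + B.indicator (fun _ => Real.exp lam - 1) x :=
    fun j hj => by simp [hg, hj]
  have hgexp : ∀ j, j ≠ i → ∀ x, g j x = if x ∈ B then Real.exp lam else 1 := by
    intro j hj x
    rw [hgj j hj]
    by_cases hx : x ∈ B <;> simp [hx]
  have hint : ∀ j, Integrable (g j) ρ := by
    intro j
    by_cases hj : j = i
    · subst hj; rw [hgi]
      exact (integrable_const (1 : ℝ)).indicator hA
    · rw [hgj j hj]
      exact (integrable_const (1 : ℝ)).add ((integrable_const _).indicator hB)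
  have hnn : ∀ j x, 0 ≤ g j x := by
    intro j x
    by_cases hj : j = i
    · subst hj; rw [hgi]; exact Set.indicator_nonneg (fun _ _ => zero_le_one) x
    · rw [hgexp j hj]; split_ifs <;> positivity
  have hmarkov := mul_meas_ge_le_integral_of_nonneg (μ := Measure.pi fun _ : ι => ρ)
    (f := fun ω => ∏ j, g j (ω j)) (ae_of_all _ fun ω => Finset.prod_nonneg fun j _ => hnn j _)
    (Integrable.fintype_prod hint) (Real.exp (lam * k))
  rw [integral_fintype_prod_eq_prod (𝕜 := ℝ) (E := fun _ => Ω) g (μ := fun _ => ρ)] at hmarkov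
  have hsub : {ω : ι → Ω | ω i ∈ A ∧
      lam * k ≤ lam * (Finset.univ.filter fun j => j ≠ i ∧ ω j ∈ B).card} ⊆
      {ω | Real.exp (lam * k) ≤ ∏ j, g j (ω j)} := by
    rintro ω ⟨h1, h2⟩
    have hprod : ∏ j, g j (ω j) =
        Real.exp (lam * (Finset.univ.filter fun j => j ≠ i ∧ ω j ∈ B).card) := by
      rw [← Finset.mul_prod_erase _ _ (Finset.mem_univ i), hgi, Set.indicator_of_mem h1,
        Pi.one_apply, one_mul, Finset.prod_congr rfl
          (fun j hj => hgexp j (Finset.ne_of_mem_erase hj) (ω j)), ← Finset.prod_filter,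
        Finset.prod_const, ← Real.exp_nat_mul, mul_comm]
      congr 4
      ext j; simp
    show Real.exp (lam * k) ≤ ∏ j, g j (ω j)
    rw [hprod]
    exact Real.exp_le_exp.2 h2
  have hprodint : ∏ j, ∫ x, g j x ∂ρ =
      ρ.real A * (1 + ρ.real B * (Real.exp lam - 1)) ^ (Fintype.card ι - 1) := by
    rw [← Finset.mul_prod_erase _ _ (Finset.mem_univ i), hgi, integral_indicator_one hA]
    congr 1
    rw [Finset.prod_congr rfl (g := fun _ => 1 + ρ.real B * (Real.exp lam - 1)),
      Finset.prod_const, Finset.card_erase_of_mem (Finset.mem_univ i), Finset.card_univ]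
    intro j hj
    rw [hgj j (Finset.ne_of_mem_erase hj), integral_add (integrable_const _)
      ((integrable_const _).indicator hB), integral_indicator_const _ hB]
    simp
  rw [hprodint] at hmarkov
  have hcard : 1 ≤ Fintype.card ι := Fintype.card_pos_iff.2 ⟨i⟩
  -- Needed to raise `1 + x ≤ exp x` to a power; for `lam < 0` it uses `ρ.real B ≤ 1`.
  have hbase : (0 : ℝ) ≤ 1 + ρ.real B * (Real.exp lam - 1) := by
    have h1 : ρ.real B ≤ 1 := measureReal_le_one
    have h2 : 0 ≤ ρ.real B := measureReal_nonneg
    nlinarith [Real.exp_pos lam]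
  have hpow : (1 + ρ.real B * (Real.exp lam - 1)) ^ (Fintype.card ι - 1) ≤
      Real.exp ((Fintype.card ι - 1 : ℝ) * ρ.real B * (Real.exp lam - 1)) := by
    rw [mul_assoc, show (Fintype.card ι - 1 : ℝ) = ((Fintype.card ι - 1 : ℕ) : ℝ) by
      push_cast [hcard]; ring, Real.exp_nat_mul]
    gcongr
    rw [add_comm]
    exact Real.add_one_le_exp _
  have h3 := (mul_le_mul_of_nonneg_left (measureReal_mono (μ := Measure.pi fun _ : ι => ρ) hsub)
    (Real.exp_pos (lam * k)).le).trans
    (hmarkov.trans (mul_le_mul_of_nonneg_left hpow measureReal_nonneg))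
  rw [Real.exp_neg, mul_assoc, ← div_eq_inv_mul, le_div_iff₀ (Real.exp_pos _), mul_comm]
  exact h3

/-! ### The BH rule in terms of counts of small p-values -/

theorem pValue_eq_normalTail (θ : Params) {m : ℕ} (x : Fin m → ℝ) (i : Fin m) :
    pValue θ x i = normalTail (|x i| / √θ.sigmaSq) :=
  two_mul_one_sub_stdNormalCDF (by positivity)

theorem sortedPValue_monotone (θ : Params) {m : ℕ} (x : Fin m → ℝ) :
    Monotone (sortedPValue θ x) :=
  Tuple.monotone_sort (pValue θ x)

theorem card_sortedPValue_le (θ : Params) {m : ℕ} (x : Fin m → ℝ) (a : ℝ) :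
    (Finset.univ.filter fun j => sortedPValue θ x j ≤ a).card =
      (Finset.univ.filter fun j => pValue θ x j ≤ a).card :=
  Finset.card_equiv (Tuple.sort (pValue θ x)) (by intro i; rw [Finset.mem_filter, Finset.mem_filter]; simp [sortedPValue])

theorem lt_card_pValue_le_iff (θ : Params) {m : ℕ} (x : Fin m → ℝ) (a : ℝ) (j : Fin m) :
    (j : ℕ) < (Finset.univ.filter fun i => pValue θ x i ≤ a).card ↔ sortedPValue θ x j ≤ a := by
  rw [← card_sortedPValue_le]
  exact Tuple.lt_card_le_iff_apply_le_of_monotone (sortedPValue_monotone θ x)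

/-- The largest admissible index serves as `r`. This replaces the random threshold by a union over
deterministic levels `r α / m`. -/
theorem exists_of_mem_benjaminiHochberg {θ : Params} {α : ℝ} {m : ℕ} {x : Fin m → ℝ} {i : Fin m}
    (h : i ∈ benjaminiHochberg θ α m x) :
    ∃ r : ℕ, 1 ≤ r ∧ r ≤ m ∧ pValue θ x i ≤ r * α / m ∧
      r ≤ (Finset.univ.filter fun j => pValue θ x j ≤ r * α / m).card := by
  obtain ⟨hne, hle⟩ := h
  set k := (bhIndices θ α x).max' hne with hk
  have hmem : k ∈ bhIndices θ α x := Finset.max'_mem _ hne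
  have hk' : sortedPValue θ x k ≤ ((k : ℕ) + 1 : ℝ) * α / m := by
    simpa [bhIndices] using hmem
  refine ⟨k + 1, by omega, k.2, ?_, ?_⟩
  · push_cast; exact hle.trans hk'
  · have := (lt_card_pValue_le_iff θ x (((k : ℕ) + 1 : ℝ) * α / m) k).2 hk'
    push_cast; exact this

/-- If `K ≥ s` p-values lie below `s α / m`, then `p_(K) ≤ s α / m ≤ K α / m`, so the index `K` is
admissible and BH rejects at least the first `K`. -/
theorem mem_benjaminiHochberg_of_card {θ : Params} {α : ℝ} (hα : 0 ≤ α) {m : ℕ} {x : Fin m → ℝ}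
    {i : Fin m} {s : ℕ} (hi : pValue θ x i ≤ s * α / m)
    (hs : s ≤ (Finset.univ.filter fun j => pValue θ x j ≤ s * α / m).card) :
    i ∈ benjaminiHochberg θ α m x := by
  set K := (Finset.univ.filter fun j => pValue θ x j ≤ s * α / m).card with hK
  have hK0 : 0 < K := Finset.card_pos.2 ⟨i, by simpa using hi⟩
  have hKm : K ≤ m := by simpa using Finset.card_le_univ (Finset.univ.filter fun j =>
    pValue θ x j ≤ s * α / m)
  -- The zero-based position of `p_(K)`.
  set k : Fin m := ⟨K - 1, by omega⟩
  have hsort : ∀ j : Fin m, (j : ℕ) < K ↔ sortedPValue θ x j ≤ s * α / m := fun j =>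
    lt_card_pValue_le_iff θ x _ j
  have hk : sortedPValue θ x k ≤ s * α / m := (hsort k).1 (Nat.sub_lt hK0 one_pos)
  have hmem : k ∈ bhIndices θ α x := by
    simp only [bhIndices, Finset.mem_filter, Finset.mem_univ, true_and]
    refine hk.trans ?_
    have : ((k : ℕ) + 1 : ℝ) = K := by
      have : (k : ℕ) + 1 = K := Nat.sub_add_cancel hK0
      exact_mod_cast this
    rw [this]
    gcongr
  refine ⟨⟨k, hmem⟩, ?_⟩
  obtain ⟨j, rfl⟩ := (Tuple.sort (pValue θ x)).surjective i
  have hj : (j : ℕ) < K := (hsort j).2 hi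
  refine sortedPValue_monotone θ x (le_trans ?_ (Finset.le_max' _ _ hmem))
  rw [Fin.le_def]
  show (j : ℕ) ≤ K - 1
  omega

/-! ### Critical regions, conditional laws and the normalized risk -/

theorem measurable_normalTail : Measurable normalTail := normalTail_antitone.measurable

namespace Params

theorem delta_pos (θ : Params) : 0 < θ.delta := div_pos θ.delta0_pos θ.deltaA_pos

theorem u_pos (θ : Params) : 0 < θ.u :=
  div_pos (by exact_mod_cast θ.tauSq_pos) (by exact_mod_cast θ.sigmaSq_pos)

theorem f_pos (θ : Params) : 0 < θ.f := div_pos (by linarith [θ.p_lt_one]) θ.p_pos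

/-- The law of an observation given whether the alternative holds. -/
noncomputable def obsLaw (θ : Params) : Bool → Measure ℝ
  | false => gaussianReal 0 θ.sigmaSq
  | true => gaussianReal 0 (θ.sigmaSq + θ.tauSq)

instance (θ : Params) (b : Bool) : IsProbabilityMeasure (θ.obsLaw b) := by
  cases b <;> (unfold obsLaw; infer_instance)

/-- The probability that the alternative holds, respectively does not hold. -/
noncomputable def prior (θ : Params) : Bool → ℝ
  | false => 1 - θ.p
  | true => θ.p

theorem prior_pos (θ : Params) (b : Bool) : 0 < θ.prior b := by
  cases b
  · exact sub_pos.2 θ.p_lt_one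
  · exact θ.p_pos

theorem pairLaw_real_prod (θ : Params) (b : Bool) (S : Set ℝ) :
    θ.pairLaw.real ({b} ×ˢ S) = θ.prior b * (θ.obsLaw b).real S := by
  have h1 : 0 ≤ 1 - θ.p := by linarith [θ.p_lt_one]
  cases b <;>
    simp [pairLaw, measureReal_def, Measure.prod_prod, prior, obsLaw, ENNReal.toReal_mul, h1,
      θ.p_pos.le]

theorem dataLaw_real_eval (θ : Params) {m : ℕ} (i : Fin m) {A : Set (Bool × ℝ)}
    (hA : MeasurableSet A) : (θ.dataLaw m).real {ω | ω i ∈ A} = θ.pairLaw.real A := by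
  have h := (measurePreserving_eval (fun _ : Fin m => θ.pairLaw) i).measureReal_preimage
    hA.nullMeasurableSet
  exact h

instance (θ : Params) (m : ℕ) : IsProbabilityMeasure (θ.dataLaw m) := by
  unfold dataLaw; infer_instance

/-- The observations whose p-value is at most `t`. -/
def critSet (θ : Params) (t : ℝ) : Set ℝ := {x | normalTail (|x| / √θ.sigmaSq) ≤ t}

theorem measurableSet_critSet (θ : Params) (t : ℝ) : MeasurableSet (θ.critSet t) :=
  measurableSet_le (measurable_normalTail.comp (by fun_prop)) measurable_const

theorem critSet_mono (θ : Params) : Monotone θ.critSet := fun _ _ hst _ hx => le_trans hx hst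

theorem sqrt_sigmaSq_pos (θ : Params) : 0 < √(θ.sigmaSq : ℝ) :=
  Real.sqrt_pos.2 (by exact_mod_cast θ.sigmaSq_pos)

theorem critSet_normalTail (θ : Params) {c : ℝ} (hc : 0 ≤ c) :
    θ.critSet (normalTail c) = {x | c * √θ.sigmaSq ≤ |x|} := by
  ext x
  simp only [critSet, Set.mem_ofPred_eq]
  rw [normalTail_le_iff (by positivity) hc, le_div_iff₀ θ.sqrt_sigmaSq_pos]

theorem sqrt_sigmaSq_add_tauSq (θ : Params) :
    √((θ.sigmaSq + θ.tauSq : ℝ≥0) : ℝ) = √(1 + θ.u) * √θ.sigmaSq := by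
  have hs : (0 : ℝ) < θ.sigmaSq := by exact_mod_cast θ.sigmaSq_pos
  rw [← Real.sqrt_mul (by linarith [θ.u_pos]), u]
  congr 1
  push_cast
  field_simp

theorem obsLaw_false_abs_ge (θ : Params) (c : ℝ) :
    (θ.obsLaw false).real {x | c * √θ.sigmaSq ≤ |x|} = normalTail c :=
  gaussianReal_abs_ge θ.sigmaSq_pos.ne' c

theorem obsLaw_true_abs_ge (θ : Params) (c : ℝ) :
    (θ.obsLaw true).real {x | c * √θ.sigmaSq ≤ |x|} = normalTail (c / √(1 + θ.u)) := by
  have hu : 0 < √(1 + θ.u) := Real.sqrt_pos.2 (by linarith [θ.u_pos])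
  rw [← gaussianReal_abs_ge (v := θ.sigmaSq + θ.tauSq)
    (add_pos θ.sigmaSq_pos θ.tauSq_pos).ne' (c / √(1 + θ.u)), sqrt_sigmaSq_add_tauSq,
    ← mul_assoc, div_mul_cancel₀ _ hu.ne']
  rfl

theorem obsLaw_false_critSet (θ : Params) {t : ℝ} (h0 : 0 < t) (h1 : t ≤ 1) :
    (θ.obsLaw false).real (θ.critSet t) = t := by
  obtain ⟨c, hc, rfl⟩ := exists_normalTail_eq h0 h1
  rw [critSet_normalTail θ hc, obsLaw_false_abs_ge]

theorem obsLaw_false_critSet_le (θ : Params) {t : ℝ} (h0 : 0 < t) :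
    (θ.obsLaw false).real (θ.critSet t) ≤ t := by
  rcases le_total t 1 with h1 | h1
  · exact (obsLaw_false_critSet θ h0 h1).le
  · exact measureReal_le_one.trans h1

theorem obsLaw_true_critSet_normalTail (θ : Params) {c : ℝ} (hc : 0 ≤ c) :
    (θ.obsLaw true).real (θ.critSet (normalTail c)) = normalTail (c / √(1 + θ.u)) := by
  rw [critSet_normalTail θ hc, obsLaw_true_abs_ge]

end Params

theorem pValue_le_iff {θ : Params} {m : ℕ} {x : Fin m → ℝ} {j : Fin m} {t : ℝ} :
    pValue θ x j ≤ t ↔ x j ∈ θ.critSet t := by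
  rw [pValue_eq_normalTail]; rfl

theorem measurableSet_eval_fst (m : ℕ) (i : Fin m) (b : Bool) :
    MeasurableSet {ω : Fin m → Bool × ℝ | (ω i).1 = b} :=
  (measurable_fst.comp (measurable_pi_apply i)) (measurableSet_singleton b)

theorem dataLaw_real_fst (θ : Params) {m : ℕ} (i : Fin m) (b : Bool) :
    (θ.dataLaw m).real {ω | (ω i).1 = b} = θ.prior b := by
  have h := θ.dataLaw_real_eval i (A := {b} ×ˢ Set.univ)
    ((measurableSet_singleton b).prod MeasurableSet.univ)
  rw [θ.pairLaw_real_prod, probReal_univ, mul_one] at h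
  rw [← h]
  congr 1; ext ω; simp [Set.mem_prod]

theorem cond_real_eq (θ : Params) {m : ℕ} (i : Fin m) (b : Bool) (E : Set (Fin m → Bool × ℝ)) :
    (ProbabilityTheory.cond (θ.dataLaw m) {ω | (ω i).1 = b}).real E =
      (θ.dataLaw m).real ({ω | (ω i).1 = b} ∩ E) / θ.prior b := by
  rw [measureReal_def, cond_apply (measurableSet_eval_fst m i b), ENNReal.toReal_mul,
    ENNReal.toReal_inv, ← measureReal_def, ← measureReal_def, dataLaw_real_fst, div_eq_inv_mul]

theorem typeIError_eq (θ : Params) {m : ℕ} (d : Rule m) (i : Fin m) :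
    typeIError θ d i =
      (θ.dataLaw m).real ({ω | (ω i).1 = false} ∩ rejectEvent d i) / (1 - θ.p) :=
  cond_real_eq θ i false _

theorem typeIIError_eq (θ : Params) {m : ℕ} (d : Rule m) (i : Fin m) :
    typeIIError θ d i =
      (θ.dataLaw m).real ({ω | (ω i).1 = true} ∩ (rejectEvent d i)ᶜ) / θ.p :=
  cond_real_eq θ i true _

/-- The Bayes risk divided by the risk `m p δ_A` of the rule that rejects nothing. -/
noncomputable def relRisk (θ : Params) {m : ℕ} (d : Rule m) : ℝ := risk θ d / (m * (θ.p * θ.deltaA))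

theorem relRisk_eq (θ : Params) {m : ℕ} (d : Rule m) :
    relRisk θ d = (∑ i, (θ.f * θ.delta * typeIError θ d i + typeIIError θ d i)) / m := by
  have h1 := θ.p_pos
  have h2 := θ.deltaA_pos
  rw [relRisk, risk, mul_comm (m : ℝ), ← div_div, Finset.sum_div]
  congr 1
  refine Finset.sum_congr rfl fun i _ => ?_
  rw [Params.f, Params.delta]
  field_simp

theorem dataLaw_real_eval_prod (θ : Params) {m : ℕ} (i : Fin m) (b : Bool) {S : Set ℝ}
    (hS : MeasurableSet S) :
    (θ.dataLaw m).real {ω | ω i ∈ ({b} : Set Bool) ×ˢ S} = θ.prior b * (θ.obsLaw b).real S := by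
  rw [θ.dataLaw_real_eval i ((measurableSet_singleton b).prod hS), θ.pairLaw_real_prod]

/-! ### Error probabilities of the BH rule for finite `m` -/

/-- A rejection at level `r` forces `r - 1` other coordinates to be signals or nulls with p-value at
most `r α / m`. Their expected number is at most `m p + r α`; as `α < 1`, this is exponentially
unlikely once `r` exceeds a large multiple of `m p`. -/
theorem exists_mem_rejectEvent_bound {α : ℝ} (hα₀ : 0 < α) (hα₁ : α < 1) :
    ∃ D η : ℝ, 0 < D ∧ 0 < η ∧ ∀ (θ : Params) (m : ℕ) (i : Fin m) (b : Bool) (r₀ : ℕ),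
      D * (m * θ.p) ≤ r₀ →
      (θ.dataLaw m).real ({ω | (ω i).1 = b} ∩ rejectEvent (benjaminiHochberg θ α m) i) ≤
        θ.prior b * ((θ.obsLaw b).real (θ.critSet (r₀ * α / m)) +
          ∑ r ∈ Finset.Ioc r₀ m,
            D * Real.exp (-η * r) * (θ.obsLaw b).real (θ.critSet (r * α / m))) := by
  classical
  -- The choice `exp lam = 1 / α` minimizes the exponent `-lam + α (exp lam - 1)` per unit of `r`;
  -- the minimum `log α + 1 - α` is negative.
  set lam : ℝ := -Real.log α with hlam
  have hexp : Real.exp lam = 1 / α := by rw [hlam, Real.exp_neg, Real.exp_log hα₀, one_div]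
  have hη : 0 < lam - (1 - α) := by
    have := Real.log_lt_sub_one_of_pos hα₀ hα₁.ne
    linarith
  -- Half of the exponential gain; the other half absorbs the contribution `m p / α` of the signals.
  set η : ℝ := (lam - (1 - α)) / 2 with hηdef
  have hη0 : 0 < η := by positivity
  have hinv : 1 < 1 / α := by rw [lt_div_iff₀ hα₀]; linarith
  refine ⟨(1 / α) * (1 + 1 / η), η, by positivity, hη0, ?_⟩
  intro θ m i b r₀ hr₀
  have hm : (0 : ℝ) < m := by exact_mod_cast i.pos
  have hp := θ.p_pos
  set μ := θ.dataLaw m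
  set A : ℕ → Set (Bool × ℝ) := fun r => {b} ×ˢ θ.critSet (r * α / m) with hA
  set B : ℕ → Set (Bool × ℝ) := fun r =>
    ({true} : Set Bool) ×ˢ Set.univ ∪ ({false} : Set Bool) ×ˢ θ.critSet (r * α / m) with hB
  have hAm : ∀ r, MeasurableSet (A r) := fun r =>
    (measurableSet_singleton b).prod (θ.measurableSet_critSet _)
  have hBm : ∀ r, MeasurableSet (B r) := fun r =>
    ((measurableSet_singleton true).prod MeasurableSet.univ).union
      ((measurableSet_singleton false).prod (θ.measurableSet_critSet _))
  -- The count omits `i`, hence `r - 1`; this keeps it independent of the event at `i`.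
  set E : ℕ → Set (Fin m → Bool × ℝ) := fun r => {ω | ω i ∈ A r ∧
    lam * ((r : ℝ) - 1) ≤ lam * (Finset.univ.filter fun j => j ≠ i ∧ ω j ∈ B r).card} with hE
  have hlam0 : 0 < lam := by linarith
  have hsub : {ω | (ω i).1 = b} ∩ rejectEvent (benjaminiHochberg θ α m) i ⊆
      {ω | ω i ∈ A r₀} ∪ ⋃ r ∈ Finset.Ioc r₀ m, E r := by
    rintro ω ⟨hb, hω⟩
    obtain ⟨r, hr1, hrm, hpi, hcard⟩ := exists_of_mem_benjaminiHochberg hω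
    rw [pValue_le_iff] at hpi
    rcases le_or_gt r r₀ with hrr | hrr
    · left
      refine ⟨hb, θ.critSet_mono ?_ hpi⟩
      gcongr
    · right
      simp only [Set.mem_iUnion]
      refine ⟨r, Finset.mem_Ioc.2 ⟨hrr, hrm⟩, ⟨hb, hpi⟩, ?_⟩
      refine mul_le_mul_of_nonneg_left ?_ hlam0.le
      rw [sub_le_iff_le_add]
      refine (Nat.cast_le.2 hcard).trans ?_
      norm_cast
      rw [← Finset.card_insert_of_notMem (a := i) (by simp)]
      refine Finset.card_le_card fun j hj => ?_
      simp only [Finset.mem_filter, Finset.mem_univ, true_and, Finset.mem_insert] at hj ⊢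
      rw [pValue_le_iff] at hj
      by_cases hji : j = i
      · exact Or.inl hji
      · right
        refine ⟨hji, ?_⟩
        rcases hν : (ω j).1 with _ | _
        · exact Or.inr ⟨hν, hj⟩
        · exact Or.inl ⟨hν, trivial⟩
  have hEb : ∀ r ∈ Finset.Ioc r₀ m, μ.real (E r) ≤ θ.prior b * ((1 / α) * (1 + 1 / η) *
      Real.exp (-η * r) * (θ.obsLaw b).real (θ.critSet (r * α / m))) := by
    intro r hr
    have hr0 : 0 < r := (Nat.zero_le _).trans_lt (Finset.mem_Ioc.1 hr).1
    have hrr : (r₀ : ℝ) ≤ r := by exact_mod_cast (Finset.mem_Ioc.1 hr).1.le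
    have h : μ.real (E r) ≤ Real.exp (-(lam * ((r : ℝ) - 1))) * θ.pairLaw.real (A r) *
        Real.exp ((Fintype.card (Fin m) - 1 : ℝ) * θ.pairLaw.real (B r) * (Real.exp lam - 1)) := by
      convert pi_real_count_le (ι := Fin m) θ.pairLaw (hAm r) (hBm r) i lam ((r : ℝ) - 1)
      rfl
    rw [Fintype.card_fin, θ.pairLaw_real_prod, hexp] at h
    have hBr : θ.pairLaw.real (B r) ≤ θ.p + r * α / m := by
      refine (measureReal_union_le _ _).trans ?_
      rw [θ.pairLaw_real_prod, θ.pairLaw_real_prod, probReal_univ, mul_one]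
      refine add_le_add le_rfl ?_
      calc θ.prior false * (θ.obsLaw false).real (θ.critSet (r * α / m))
          ≤ 1 * (r * α / m) := by
            refine mul_le_mul ?_ (θ.obsLaw_false_critSet_le (by positivity)) measureReal_nonneg
              zero_le_one
            show 1 - θ.p ≤ 1
            linarith
        _ = _ := one_mul _
    have hexpo : ((m : ℝ) - 1) * θ.pairLaw.real (B r) * (1 / α - 1) ≤
        m * θ.p * (1 / α) + r * (1 - α) := by
      calc ((m : ℝ) - 1) * θ.pairLaw.real (B r) * (1 / α - 1)
          ≤ m * (θ.p + r * α / m) * (1 / α - 1) := by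
            refine mul_le_mul_of_nonneg_right ?_ (by linarith)
            exact mul_le_mul (by linarith) hBr measureReal_nonneg hm.le
        _ = m * θ.p * (1 / α - 1) + r * (1 - α) := by field_simp
        _ ≤ _ := by
            have : 0 < (m : ℝ) * θ.p := by positivity
            nlinarith
    have hmp : m * θ.p * (1 / α) ≤ η * r := by
      have h1 : (1 / α) * (1 / η) * (m * θ.p) ≤ r := by
        refine le_trans ?_ (hr₀.trans hrr)
        have : 0 < (1 / α) * (m * θ.p) := by positivity
        nlinarith
      calc m * θ.p * (1 / α) = η * ((1 / α) * (1 / η) * (m * θ.p)) := by field_simp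
        _ ≤ η * r := by gcongr
    refine h.trans ?_
    have hfin : Real.exp (-(lam * ((r : ℝ) - 1))) *
        Real.exp (((m : ℝ) - 1) * θ.pairLaw.real (B r) * (1 / α - 1)) ≤
        (1 / α) * (1 + 1 / η) * Real.exp (-η * r) := by
      rw [← Real.exp_add]
      calc Real.exp (-(lam * ((r : ℝ) - 1)) +
            ((m : ℝ) - 1) * θ.pairLaw.real (B r) * (1 / α - 1))
          ≤ Real.exp (lam + -η * r) := by
            apply Real.exp_le_exp.2
            have : lam = 2 * η + (1 - α) := by rw [hηdef]; ring
            nlinarith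
        _ = (1 / α) * Real.exp (-η * r) := by rw [Real.exp_add, hexp]
        _ ≤ _ := by
            refine mul_le_mul_of_nonneg_right ?_ (Real.exp_pos _).le
            have : 0 < (1 / α) * (1 / η) := by positivity
            linarith
    have hw : 0 ≤ θ.prior b * (θ.obsLaw b).real (θ.critSet (r * α / m)) :=
      mul_nonneg (θ.prior_pos b).le measureReal_nonneg
    nlinarith [mul_le_mul_of_nonneg_right hfin hw]
  calc μ.real ({ω | (ω i).1 = b} ∩ rejectEvent (benjaminiHochberg θ α m) i)
      ≤ μ.real ({ω | ω i ∈ A r₀} ∪ ⋃ r ∈ Finset.Ioc r₀ m, E r) := measureReal_mono hsub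
    _ ≤ μ.real {ω | ω i ∈ A r₀} + ∑ r ∈ Finset.Ioc r₀ m, μ.real (E r) :=
        (measureReal_union_le _ _).trans
          (add_le_add le_rfl (measureReal_biUnion_finset_le _ _))
    _ ≤ _ := by
        rw [mul_add, Finset.mul_sum]
        refine add_le_add ?_ (Finset.sum_le_sum hEb)
        exact (dataLaw_real_eval_prod θ i b (θ.measurableSet_critSet _)).le

theorem exists_sum_exp_bound {η : ℝ} (hη : 0 < η) :
    ∃ C : ℝ, 0 < C ∧ ∀ s : Finset ℕ, ∑ r ∈ s, Real.exp (-η * r) * r ≤ C := by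
  have hs : Summable fun r : ℕ => Real.exp (-η * r) * r := by
    have := Real.summable_pow_mul_exp_neg_nat_mul 1 hη
    simpa [mul_comm] using this
  refine ⟨(∑' r : ℕ, Real.exp (-η * r) * r) + 1, ?_, fun s => ?_⟩
  · have : 0 ≤ ∑' r : ℕ, Real.exp (-η * r) * r := tsum_nonneg fun r => by positivity
    linarith
  · have := hs.sum_le_tsum s fun r _ => by positivity
    linarith

/-- The probability of a type I error of the BH rule is `O(p + 1 / m)`. -/
theorem exists_typeIError_le {α : ℝ} (hα₀ : 0 < α) (hα₁ : α < 1) :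
    ∃ K : ℝ, 0 < K ∧ ∀ (θ : Params) (m : ℕ) (i : Fin m),
      typeIError θ (benjaminiHochberg θ α m) i ≤ K * (θ.p + 1 / m) := by
  obtain ⟨D, η, hD, hη, hbound⟩ := exists_mem_rejectEvent_bound hα₀ hα₁
  obtain ⟨C, hC, hsum⟩ := exists_sum_exp_bound hη
  refine ⟨D + 1 + D * C, by positivity, fun θ m i => ?_⟩
  have hm : (0 : ℝ) < m := by exact_mod_cast i.pos
  have hp := θ.p_pos
  set r₀ : ℕ := ⌈D * (m * θ.p)⌉₊ with hr₀
  have hr₀pos : 0 < r₀ := Nat.ceil_pos.2 (by positivity)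
  have hr₀pos' : (0 : ℝ) < r₀ := by exact_mod_cast hr₀pos
  have hr₀le : (r₀ : ℝ) ≤ D * (m * θ.p) + 1 := (Nat.ceil_lt_add_one (by positivity)).le
  have h := hbound θ m i false r₀ (Nat.le_ceil _)
  rw [typeIError_eq, div_le_iff₀ (sub_pos.2 θ.p_lt_one)]
  refine h.trans ?_
  rw [mul_comm]
  show _ * (1 - θ.p) ≤ _
  refine mul_le_mul_of_nonneg_right ?_ (sub_pos.2 θ.p_lt_one).le
  have h1 : (θ.obsLaw false).real (θ.critSet (r₀ * α / m)) ≤ r₀ * α / m :=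
    θ.obsLaw_false_critSet_le (by positivity)
  have h2 : ∑ r ∈ Finset.Ioc r₀ m,
      D * Real.exp (-η * r) * (θ.obsLaw false).real (θ.critSet (r * α / m)) ≤
      D * (α / m) * C := by
    calc _ ≤ ∑ r ∈ Finset.Ioc r₀ m, D * (α / m) * (Real.exp (-η * r) * r) := by
          refine Finset.sum_le_sum fun r hr => ?_
          have hr0 : 0 < r := (Nat.zero_le _).trans_lt (Finset.mem_Ioc.1 hr).1
          have := θ.obsLaw_false_critSet_le (t := r * α / m) (by positivity)
          calc _ ≤ D * Real.exp (-η * r) * (r * α / m) := by gcongr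
            _ = _ := by ring
      _ ≤ _ := by
          rw [← Finset.mul_sum]
          gcongr
          exact hsum _
  calc _ ≤ r₀ * α / m + D * (α / m) * C := add_le_add h1 h2
    _ = α * ((r₀ + D * C) / m) := by ring
    _ ≤ 1 * ((D * (m * θ.p) + 1 + D * C) / m) := by gcongr
    _ = D * θ.p + (1 + D * C) * (1 / m) := by field_simp; ring
    _ ≤ _ := by
      have : 0 < 1 / (m : ℝ) := by positivity
      nlinarith [mul_pos hD this, mul_pos (mul_pos hD hC) hp]

/-- A lower bound for the probability of a type II error of the BH rule: the threshold of the BH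
rule does not exceed `r₀ α / m` up to an error probability `O(1 / r₀)`. -/
theorem exists_le_typeIIError {α : ℝ} (hα₀ : 0 < α) (hα₁ : α < 1) :
    ∃ K : ℝ, 0 < K ∧ ∀ (θ : Params) (m : ℕ) (i : Fin m) (r₀ : ℕ), 0 < r₀ →
      K * (m * θ.p) ≤ r₀ →
      1 - (θ.obsLaw true).real (θ.critSet (r₀ * α / m)) - K / r₀ ≤
        typeIIError θ (benjaminiHochberg θ α m) i := by
  obtain ⟨D, η, hD, hη, hbound⟩ := exists_mem_rejectEvent_bound hα₀ hα₁
  obtain ⟨C, hC, hsum⟩ := exists_sum_exp_bound hη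
  refine ⟨D + D * C, by positivity, fun θ m i r₀ hr₀pos hr₀ => ?_⟩
  have hm : (0 : ℝ) < m := by exact_mod_cast i.pos
  have hp := θ.p_pos
  have hr₀pos' : (0 : ℝ) < r₀ := by exact_mod_cast hr₀pos
  have h := hbound θ m i true r₀ (le_trans (by
    have : 0 < D * C * (m * θ.p) := by positivity
    nlinarith) hr₀)
  set E := rejectEvent (benjaminiHochberg θ α m) i
  have hun : θ.p ≤ (θ.dataLaw m).real ({ω | (ω i).1 = true} ∩ E) +
      (θ.dataLaw m).real ({ω | (ω i).1 = true} ∩ Eᶜ) := by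
    have h1 := dataLaw_real_fst θ i true
    refine (h1.symm.le.trans ?_)
    rw [← Set.inter_union_compl {ω : Fin m → Bool × ℝ | (ω i).1 = true} E]
    refine (measureReal_union_le _ _).trans (le_of_eq ?_)
    rw [Set.inter_union_compl]
  have h2 : ∑ r ∈ Finset.Ioc r₀ m,
      D * Real.exp (-η * r) * (θ.obsLaw true).real (θ.critSet (r * α / m)) ≤ D * C / r₀ := by
    -- Inserting the factor `r / r₀ ≥ 1` extracts the decay `1 / r₀` from a convergent series.
    calc _ ≤ ∑ r ∈ Finset.Ioc r₀ m, D / r₀ * (Real.exp (-η * r) * r) := by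
          refine Finset.sum_le_sum fun r hr => ?_
          have hr0 : (r₀ : ℝ) ≤ r := by exact_mod_cast (Finset.mem_Ioc.1 hr).1.le
          calc _ ≤ D * Real.exp (-η * r) * 1 := by
                gcongr
                exact measureReal_le_one
            _ ≤ D * Real.exp (-η * r) * (r / r₀) := by
                gcongr
                rwa [one_le_div hr₀pos']
            _ = _ := by ring
      _ ≤ _ := by
          rw [← Finset.mul_sum, mul_div_right_comm]
          gcongr
          exact hsum _
  have h3 : θ.prior true = θ.p := rfl
  rw [h3] at h
  rw [typeIIError_eq, le_div_iff₀ hp]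
  have h4 : (D + D * C) / r₀ = D / r₀ + D * C / r₀ := add_div _ _ _
  have h5 : 0 ≤ D / r₀ := by positivity
  rw [h4]
  nlinarith

/-- Signals with p-value at most `α / m` already guarantee a BH threshold of order `p`: about `m p
q` of them are expected, and a count below a fixed fraction of this is a Chernoff deviation. When `m
p < M` the single level `s = 1` suffices, with no exceptional event. -/
theorem exists_rejection_number {α : ℝ} (hα₀ : 0 < α) (θ : Params) {m : ℕ} (hm : 2 ≤ m)
    {M : ℝ} (hM : 0 < M) :
    ∃ s : ℕ, 1 ≤ s ∧ s ≤ m ∧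
      min (1 / M) ((θ.obsLaw true).real (θ.critSet (α / m)) / 8) * (m * θ.p) ≤ s ∧
      ∀ (b : Bool) (i : Fin m), (θ.dataLaw m).real {ω | ω i ∈ ({b} : Set Bool) ×ˢ
          θ.critSet (s * α / m) ∧ i ∉ benjaminiHochberg θ α m (fun j => (ω j).2)} ≤
        Real.exp (-(M * (θ.obsLaw true).real (θ.critSet (α / m)) / 8)) *
          (θ.prior b * (θ.obsLaw b).real (θ.critSet (s * α / m))) := by
  classical
  set q := (θ.obsLaw true).real (θ.critSet (α / m)) with hq
  have hq0 : 0 ≤ q := measureReal_nonneg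
  have hq1 : q ≤ 1 := measureReal_le_one
  have hm0 : (2 : ℝ) ≤ m := by exact_mod_cast hm
  have hp := θ.p_pos
  have hp1 := θ.p_lt_one
  rcases lt_or_ge (m * θ.p) M with hlt | hge
  · refine ⟨1, le_rfl, by omega, ?_, fun b i => ?_⟩
    · calc _ ≤ 1 / M * (m * θ.p) := by gcongr; exact min_le_left _ _
        _ ≤ 1 / M * M := by gcongr
        _ = _ := by field_simp; norm_num
    · have hempty : {ω : Fin m → Bool × ℝ | ω i ∈ ({b} : Set Bool) ×ˢ
          θ.critSet ((1 : ℕ) * α / m) ∧ i ∉ benjaminiHochberg θ α m (fun j => (ω j).2)} = ∅ := by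
        rw [Set.eq_empty_iff_forall_notMem]
        rintro ω ⟨⟨_, h1⟩, h2⟩
        have hi : pValue θ (fun j => (ω j).2) i ≤ (1 : ℕ) * α / m := pValue_le_iff.2 h1
        exact h2 (mem_benjaminiHochberg_of_card hα₀.le hi
          (Finset.card_pos.2 ⟨i, by simpa using hi⟩))
      rw [hempty, measureReal_empty]
      have := (θ.prior_pos b).le
      have : 0 ≤ (θ.obsLaw b).real (θ.critSet ((1 : ℕ) * α / m)) := measureReal_nonneg
      positivity
  · set k : ℕ := ⌊m * θ.p * q / 8⌋₊ with hk
    have hkle : (k : ℝ) ≤ m * θ.p * q / 8 := Nat.floor_le (by positivity)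
    have hklt : m * θ.p * q / 8 < k + 1 := Nat.lt_floor_add_one _
    refine ⟨k + 1, by omega, ?_, ?_, fun b i => ?_⟩
    · have h1 : (k : ℝ) ≤ m / 8 := by
        refine hkle.trans ?_
        have : (m : ℝ) * θ.p * q ≤ m * 1 * 1 := by gcongr
        linarith
      have h2 : (k : ℝ) + 1 ≤ m := by linarith
      exact_mod_cast h2
    · push_cast
      calc _ ≤ q / 8 * (m * θ.p) := by gcongr; exact min_le_right _ _
        _ = m * θ.p * q / 8 := by ring
        _ ≤ _ := hklt.le
    · set s : ℕ := k + 1 with hs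
      have hmk : 0 < m := by omega
      set A : Set (Bool × ℝ) := {b} ×ˢ θ.critSet (s * α / m) with hA
      set B : Set (Bool × ℝ) := ({true} : Set Bool) ×ˢ θ.critSet (α / m) with hB
      have hAm : MeasurableSet A := (measurableSet_singleton b).prod (θ.measurableSet_critSet _)
      have hBm : MeasurableSet B := (measurableSet_singleton true).prod (θ.measurableSet_critSet _)
      -- Lower deviation, with parameter `-1`. The mean is at least `m p q / 2`, so the exponent is
      -- at most `k - m p q / 4 ≤ -m p q / 8`.
      have h : (θ.dataLaw m).real {ω | ω i ∈ A ∧ (-1 : ℝ) * k ≤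
            (-1) * (Finset.univ.filter fun j => j ≠ i ∧ ω j ∈ B).card} ≤
          Real.exp (-((-1) * k)) * θ.pairLaw.real A *
          Real.exp ((Fintype.card (Fin m) - 1 : ℝ) * θ.pairLaw.real B * (Real.exp (-1) - 1)) := by
        convert pi_real_count_le (ι := Fin m) θ.pairLaw hAm hBm i (-1) (k : ℝ)
        rfl
      have hsub : {ω : Fin m → Bool × ℝ | ω i ∈ A ∧
          i ∉ benjaminiHochberg θ α m (fun j => (ω j).2)} ⊆ {ω | ω i ∈ A ∧ (-1 : ℝ) * k ≤
            (-1) * (Finset.univ.filter fun j => j ≠ i ∧ ω j ∈ B).card} := by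
        rintro ω ⟨h1, h2⟩
        refine ⟨h1, ?_⟩
        by_contra hcon
        have hcon' : (k : ℝ) < (Finset.univ.filter fun j => j ≠ i ∧ ω j ∈ B).card := by
          linarith [not_le.1 hcon]
        rw [Nat.cast_lt] at hcon'
        have hi : pValue θ (fun j => (ω j).2) i ≤ s * α / m := pValue_le_iff.2 h1.2
        refine h2 (mem_benjaminiHochberg_of_card hα₀.le hi ?_)
        refine (Nat.succ_le_of_lt hcon').trans (Finset.card_le_card fun j hj => ?_)
        simp only [Finset.mem_filter, Finset.mem_univ, true_and] at hj ⊢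
        refine pValue_le_iff.2 (θ.critSet_mono ?_ hj.2.2)
        gcongr
        have : (1 : ℝ) ≤ s := by rw [hs]; push_cast; linarith [(Nat.cast_nonneg k : (0 : ℝ) ≤ k)]
        nlinarith
      refine (measureReal_mono hsub).trans (h.trans ?_)
      rw [θ.pairLaw_real_prod, θ.pairLaw_real_prod, Fintype.card_fin]
      set w := θ.prior b * (θ.obsLaw b).real (θ.critSet (s * α / m)) with hw
      have hw0 : 0 ≤ w := mul_nonneg (θ.prior_pos b).le measureReal_nonneg
      rw [mul_right_comm, ← Real.exp_add]
      refine mul_le_mul_of_nonneg_right (Real.exp_le_exp.2 ?_) hw0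
      have he : Real.exp (-1) - 1 ≤ -(1 / 2) := by
        have h1 : Real.exp (-1) * Real.exp 1 = 1 := by rw [← Real.exp_add]; simp
        have h2 := Real.exp_one_gt_d9
        have h3 := Real.exp_pos (-1)
        nlinarith
      show -(-1 * (k : ℝ)) + ((m : ℝ) - 1) * (θ.p * q) * (Real.exp (-1) - 1) ≤ -(M * q / 8)
      have hpq : 0 ≤ θ.p * q := by positivity
      have h1 : ((m : ℝ) - 1) * (θ.p * q) * (Real.exp (-1) - 1) ≤ m / 2 * (θ.p * q) * -(1 / 2) := by
        have h4 : (m : ℝ) / 2 * (θ.p * q) ≤ (m - 1) * (θ.p * q) := by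
          gcongr
          linarith
        have h5 : 0 ≤ (m : ℝ) / 2 * (θ.p * q) := by positivity
        nlinarith
      have h6 : M * q ≤ m * θ.p * q := by gcongr
      nlinarith

/-- A lower bound for the probability of a type I error of the BH rule. -/
theorem le_typeIError {α : ℝ} (hα₀ : 0 < α) (hα₁ : α < 1) (θ : Params) {m : ℕ} (hm : 2 ≤ m)
    (i : Fin m) {M : ℝ} (hM : 0 < M) :
    (1 - Real.exp (-(M * (θ.obsLaw true).real (θ.critSet (α / m)) / 8))) *
      (α * min (1 / M) ((θ.obsLaw true).real (θ.critSet (α / m)) / 8) * θ.p) ≤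
      typeIError θ (benjaminiHochberg θ α m) i := by
  obtain ⟨s, hs1, hsm, hs, hrej⟩ := exists_rejection_number hα₀ θ hm hM
  set q := (θ.obsLaw true).real (θ.critSet (α / m)) with hq
  have hq0 : 0 ≤ q := measureReal_nonneg
  have hm0 : (0 : ℝ) < m := by exact_mod_cast i.pos
  have hs0 : (0 : ℝ) < s := by exact_mod_cast hs1
  have h := hrej false i
  have hsm' : (s : ℝ) ≤ m := by exact_mod_cast hsm
  have hle1 : s * α / m ≤ 1 := by
    rw [div_le_one hm0]
    nlinarith
  have hev := dataLaw_real_eval_prod θ i false (θ.measurableSet_critSet (s * α / m))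
  have hun : (θ.dataLaw m).real {ω | ω i ∈ ({false} : Set Bool) ×ˢ θ.critSet (s * α / m)} ≤
      (θ.dataLaw m).real
        ({ω | (ω i).1 = false} ∩ rejectEvent (benjaminiHochberg θ α m) i) +
      (θ.dataLaw m).real {ω | ω i ∈ ({false} : Set Bool) ×ˢ θ.critSet (s * α / m) ∧
        i ∉ benjaminiHochberg θ α m (fun j => (ω j).2)} := by
    refine (measureReal_mono ?_).trans (measureReal_union_le _ _)
    intro ω hω
    by_cases hi : i ∈ benjaminiHochberg θ α m (fun j => (ω j).2)
    · exact Or.inl ⟨hω.1, hi⟩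
    · exact Or.inr ⟨hω, hi⟩
  rw [hev] at hun
  rw [θ.obsLaw_false_critSet (by positivity) hle1] at h hun
  have hpr : θ.prior false = 1 - θ.p := rfl
  rw [hpr] at h hun
  rw [typeIError_eq, le_div_iff₀ (sub_pos.2 θ.p_lt_one)]
  set e := Real.exp (-(M * q / 8)) with he
  have he1 : e ≤ 1 := Real.exp_le_one_iff.2 (by
    have : 0 ≤ M * q := by positivity
    linarith)
  have h1p := sub_pos.2 θ.p_lt_one
  calc (1 - e) * (α * min (1 / M) (q / 8) * θ.p) * (1 - θ.p)
      = (1 - e) * (α * (min (1 / M) (q / 8) * (m * θ.p)) / m) * (1 - θ.p) := by field_simp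
    _ ≤ (1 - e) * (s * α / m) * (1 - θ.p) := by
        have : 0 ≤ 1 - e := by linarith
        rw [mul_comm (s : ℝ)]
        gcongr
    _ ≤ _ := by linarith

/-- An upper bound for the probability of a type II error of the BH rule. -/
theorem typeIIError_le {α : ℝ} (hα₀ : 0 < α) (θ : Params) {m : ℕ} (hm : 2 ≤ m)
    (i : Fin m) {M : ℝ} (hM : 0 < M) :
    typeIIError θ (benjaminiHochberg θ α m) i ≤ 1 - (θ.obsLaw true).real (θ.critSet
        (α * min (1 / M) ((θ.obsLaw true).real (θ.critSet (α / m)) / 8) * θ.p)) +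
      Real.exp (-(M * (θ.obsLaw true).real (θ.critSet (α / m)) / 8)) := by
  obtain ⟨s, hs1, hsm, hs, hrej⟩ := exists_rejection_number hα₀ θ hm hM
  set q := (θ.obsLaw true).real (θ.critSet (α / m)) with hq
  have hm0 : (0 : ℝ) < m := by exact_mod_cast i.pos
  have hp := θ.p_pos
  have h := hrej true i
  have hev := dataLaw_real_eval_prod θ i true (θ.measurableSet_critSet (s * α / m)).compl
  have hun : (θ.dataLaw m).real
        ({ω | (ω i).1 = true} ∩ (rejectEvent (benjaminiHochberg θ α m) i)ᶜ) ≤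
      (θ.dataLaw m).real {ω | ω i ∈ ({true} : Set Bool) ×ˢ (θ.critSet (s * α / m))ᶜ} +
      (θ.dataLaw m).real {ω | ω i ∈ ({true} : Set Bool) ×ˢ θ.critSet (s * α / m) ∧
        i ∉ benjaminiHochberg θ α m (fun j => (ω j).2)} := by
    refine (measureReal_mono ?_).trans (measureReal_union_le _ _)
    rintro ω ⟨h1, h2⟩
    by_cases hi : (ω i).2 ∈ θ.critSet (s * α / m)
    · exact Or.inr ⟨⟨h1, hi⟩, h2⟩
    · exact Or.inl ⟨h1, hi⟩
  rw [hev, probReal_compl_eq_one_sub (θ.measurableSet_critSet _)] at hun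
  have hpr : θ.prior true = θ.p := rfl
  rw [hpr] at h hun
  have hmono : (θ.obsLaw true).real (θ.critSet (α * min (1 / M) (q / 8) * θ.p)) ≤
      (θ.obsLaw true).real (θ.critSet (s * α / m)) := by
    refine measureReal_mono (θ.critSet_mono ?_)
    rw [le_div_iff₀ hm0]
    nlinarith
  have h1 : (θ.obsLaw true).real (θ.critSet (s * α / m)) ≤ 1 := measureReal_le_one
  rw [typeIIError_eq, div_le_iff₀ hp]
  have he := Real.exp_pos (-(M * q / 8))
  have h2 : Real.exp (-(M * q / 8)) * (θ.p * (θ.obsLaw true).real (θ.critSet (s * α / m))) ≤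
      Real.exp (-(M * q / 8)) * (θ.p * 1) := by gcongr
  nlinarith

/-! ### The risk of the Bayes oracle -/

/-- The rule that rejects the `i`-th hypothesis if and only if the `i`-th observation lies in `S`. -/
def coordRule (m : ℕ) (S : Set ℝ) : Rule m := fun x => {i | x i ∈ S}

theorem relRisk_coordRule (θ : Params) {m : ℕ} (hm : 0 < m) {S : Set ℝ} (hS : MeasurableSet S) :
    relRisk θ (coordRule m S) =
      θ.f * θ.delta * (θ.obsLaw false).real S + (θ.obsLaw true).real Sᶜ := by
  have hm0 : (m : ℝ) ≠ 0 := by positivity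
  have key : ∀ (i : Fin m) (b : Bool) {T : Set ℝ}, MeasurableSet T →
      (θ.dataLaw m).real ({ω | (ω i).1 = b} ∩ {ω | (ω i).2 ∈ T}) / θ.prior b =
        (θ.obsLaw b).real T := by
    intro i b T hT
    rw [div_eq_iff (θ.prior_pos b).ne', mul_comm, ← dataLaw_real_eval_prod θ i b hT]
    rfl
  have h1 : ∀ i, typeIError θ (coordRule m S) i = (θ.obsLaw false).real S := fun i => by
    rw [typeIError_eq]; exact key i false hS
  have h2 : ∀ i, typeIIError θ (coordRule m S) i = (θ.obsLaw true).real Sᶜ := fun i => by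
    rw [typeIIError_eq]; exact key i true hS.compl
  rw [relRisk_eq]
  simp only [h1, h2, Finset.sum_const, Finset.card_univ, Fintype.card_fin, nsmul_eq_mul]
  field_simp

/-- The rejection region of the Bayes oracle. -/
def oracleSet (θ : Params) : Set ℝ :=
  {x | gaussianPDFReal 0 θ.sigmaSq x * (θ.f * θ.delta) -
    gaussianPDFReal 0 (θ.sigmaSq + θ.tauSq) x ≤ 0}

theorem bayesOracle_eq (θ : Params) (m : ℕ) : bayesOracle θ m = coordRule m (oracleSet θ) := by
  funext x
  ext i
  have h0 := gaussianPDFReal_pos 0 θ.sigmaSq (x i) θ.sigmaSq_pos.ne'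
  have h : (1 - θ.p) * θ.delta0 / (θ.p * θ.deltaA) = θ.f * θ.delta := by
    rw [Params.f, Params.delta, div_mul_div_comm]
  simp only [bayesOracle, coordRule, oracleSet, Set.mem_ofPred_eq]
  rw [h, le_div_iff₀ h0, sub_nonpos, mul_comm]

theorem measurableSet_oracleSet (θ : Params) : MeasurableSet (oracleSet θ) :=
  measurableSet_le (((measurable_gaussianPDFReal _ _).mul_const _).sub
    (measurable_gaussianPDFReal _ _)) measurable_const

theorem gaussianReal_real_eq_setIntegral {v : ℝ≥0} (hv : v ≠ 0) (S : Set ℝ) :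
    (gaussianReal 0 v).real S = ∫ x in S, gaussianPDFReal 0 v x := by
  rw [measureReal_def, gaussianReal_apply_eq_integral 0 hv, ENNReal.toReal_ofReal
    (integral_nonneg fun x => gaussianPDFReal_nonneg 0 v x)]

/-- The Bayes oracle has the least risk among all rules that test coordinate by coordinate. -/
theorem relRisk_bayesOracle_le (θ : Params) {m : ℕ} (hm : 0 < m) {S : Set ℝ}
    (hS : MeasurableSet S) : relRisk θ (bayesOracle θ m) ≤
      θ.f * θ.delta * (θ.obsLaw false).real S + (θ.obsLaw true).real Sᶜ := by
  rw [bayesOracle_eq, relRisk_coordRule θ hm (measurableSet_oracleSet θ)]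
  have h0 := integrable_gaussianPDFReal 0 θ.sigmaSq
  have h1 := integrable_gaussianPDFReal 0 (θ.sigmaSq + θ.tauSq)
  have key : ∀ T : Set ℝ, MeasurableSet T →
      θ.f * θ.delta * (θ.obsLaw false).real T + (θ.obsLaw true).real Tᶜ =
      1 + ∫ x in T, (gaussianPDFReal 0 θ.sigmaSq x * (θ.f * θ.delta) -
        gaussianPDFReal 0 (θ.sigmaSq + θ.tauSq) x) := by
    intro T hT
    rw [integral_sub (h0.mul_const _).integrableOn h1.integrableOn, integral_mul_const,
      ← gaussianReal_real_eq_setIntegral θ.sigmaSq_pos.ne',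
      ← gaussianReal_real_eq_setIntegral (add_pos θ.sigmaSq_pos θ.tauSq_pos).ne',
      probReal_compl_eq_one_sub hT]
    simp only [Params.obsLaw]
    ring
  rw [key _ (measurableSet_oracleSet θ), key _ hS]
  -- The oracle region is exactly where the integrand is nonpositive, so it minimizes the integral
  -- (Neyman–Pearson).
  have := setIntegral_nonpos_le (μ := volume) hS
    (f := fun x => gaussianPDFReal 0 θ.sigmaSq x * (θ.f * θ.delta) -
        gaussianPDFReal 0 (θ.sigmaSq + θ.tauSq) x)
    (((stronglyMeasurable_gaussianPDFReal _ _).mul_const _).sub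
      (stronglyMeasurable_gaussianPDFReal _ _)) ((h0.mul_const _).sub h1)
  exact add_le_add le_rfl this

theorem relRisk_bayesOracle_le_one (θ : Params) {m : ℕ} (hm : 0 < m) :
    relRisk θ (bayesOracle θ m) ≤ 1 := by
  simpa using relRisk_bayesOracle_le θ hm MeasurableSet.empty

theorem relRisk_bayesOracle_le_threshold (θ : Params) {m : ℕ} (hm : 0 < m) (c : ℝ) :
    relRisk θ (bayesOracle θ m) ≤
      θ.f * θ.delta * normalTail c + (1 - normalTail (c / √(1 + θ.u))) := by
  have hS : MeasurableSet {x : ℝ | c * √θ.sigmaSq ≤ |x|} :=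
    measurableSet_le measurable_const measurable_id.abs
  have := relRisk_bayesOracle_le θ hm hS
  rwa [probReal_compl_eq_one_sub hS, θ.obsLaw_false_abs_ge, θ.obsLaw_true_abs_ge] at this

/-- The right side is the peak of the null density, which dominates the lower peak of the wider
alternative density. -/
theorem gaussianPDFReal_add_le (θ : Params) (x : ℝ) :
    gaussianPDFReal 0 (θ.sigmaSq + θ.tauSq) x ≤
      gaussianPDFReal 0 θ.sigmaSq x * Real.exp (x ^ 2 / (2 * θ.sigmaSq)) := by
  have hs : (0 : ℝ) < θ.sigmaSq := by exact_mod_cast θ.sigmaSq_pos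
  have ht : (0 : ℝ) < θ.tauSq := by exact_mod_cast θ.tauSq_pos
  have h1 : gaussianPDFReal 0 θ.sigmaSq x * Real.exp (x ^ 2 / (2 * θ.sigmaSq)) =
      (√(2 * Real.pi * θ.sigmaSq))⁻¹ := by
    rw [gaussianPDFReal, mul_assoc, ← Real.exp_add]
    have : -(x - 0) ^ 2 / (2 * (θ.sigmaSq : ℝ)) + x ^ 2 / (2 * θ.sigmaSq) = 0 := by ring
    rw [this, Real.exp_zero, mul_one]
  rw [h1, gaussianPDFReal]
  have h2 : Real.exp (-(x - 0) ^ 2 / (2 * ((θ.sigmaSq + θ.tauSq : ℝ≥0) : ℝ))) ≤ 1 :=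
    Real.exp_le_one_iff.2 (div_nonpos_of_nonpos_of_nonneg (by nlinarith [sq_nonneg (x - 0)])
      (by positivity))
  calc _ ≤ (√(2 * Real.pi * ((θ.sigmaSq + θ.tauSq : ℝ≥0) : ℝ)))⁻¹ * 1 := by gcongr
    _ ≤ _ := by
      rw [mul_one]
      have : (θ.sigmaSq : ℝ) ≤ ((θ.sigmaSq + θ.tauSq : ℝ≥0) : ℝ) := by push_cast; linarith
      have hpi := Real.pi_pos
      gcongr

/-- The likelihood ratio is at most `exp (x² / (2σ²))`, so the oracle can reject only where this
reaches `f δ`, hence only for `|x| ≥ c σ`. Its type II error alone gives the bound. -/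
theorem le_relRisk_bayesOracle (θ : Params) {m : ℕ} (hm : 0 < m) {c : ℝ} (hc : 0 ≤ c)
    (h : c ^ 2 ≤ 2 * (Real.log θ.f + Real.log θ.delta)) :
    1 - normalTail (c / √(1 + θ.u)) ≤ relRisk θ (bayesOracle θ m) := by
  have hs : (0 : ℝ) < θ.sigmaSq := by exact_mod_cast θ.sigmaSq_pos
  have hf := θ.f_pos
  have hδ := θ.delta_pos
  rw [bayesOracle_eq, relRisk_coordRule θ hm (measurableSet_oracleSet θ)]
  have hsub : oracleSet θ ⊆ {x | c * √θ.sigmaSq ≤ |x|} := by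
    intro x hx
    have h0 := gaussianPDFReal_pos 0 θ.sigmaSq x θ.sigmaSq_pos.ne'
    have h1 : gaussianPDFReal 0 θ.sigmaSq x * (θ.f * θ.delta) ≤
        gaussianPDFReal 0 θ.sigmaSq x * Real.exp (x ^ 2 / (2 * θ.sigmaSq)) :=
      (sub_nonpos.1 hx).trans (gaussianPDFReal_add_le θ x)
    have h2 : θ.f * θ.delta ≤ Real.exp (x ^ 2 / (2 * θ.sigmaSq)) := le_of_mul_le_mul_left h1 h0
    have h3 := Real.log_le_log (by positivity) h2
    rw [Real.log_exp, Real.log_mul hf.ne' hδ.ne', le_div_iff₀ (by positivity)] at h3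
    show c * √θ.sigmaSq ≤ |x|
    refine (pow_le_pow_iff_left₀ (by positivity) (abs_nonneg x) two_ne_zero).1 ?_
    rw [mul_pow, Real.sq_sqrt hs.le, sq_abs]
    nlinarith
  have h1 : (θ.obsLaw true).real {x | c * √θ.sigmaSq ≤ |x|}ᶜ ≤
      (θ.obsLaw true).real (oracleSet θ)ᶜ := measureReal_mono (Set.compl_subset_compl.2 hsub)
  have hS : MeasurableSet {x : ℝ | c * √θ.sigmaSq ≤ |x|} :=
    measurableSet_le measurable_const measurable_id.abs
  rw [probReal_compl_eq_one_sub hS, θ.obsLaw_true_abs_ge] at h1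
  have h2 : 0 ≤ θ.f * θ.delta * (θ.obsLaw false).real (oracleSet θ) :=
    mul_nonneg (by positivity) measureReal_nonneg
  linarith

theorem relRisk_bayesOracle_nonneg (θ : Params) {m : ℕ} (hm : 0 < m) :
    0 ≤ relRisk θ (bayesOracle θ m) := by
  rw [bayesOracle_eq, relRisk_coordRule θ hm (measurableSet_oracleSet θ)]
  have := mul_nonneg (mul_pos θ.f_pos θ.delta_pos).le
    (measureReal_nonneg (μ := θ.obsLaw false) (s := oracleSet θ))
  have := measureReal_nonneg (μ := θ.obsLaw true) (s := (oracleSet θ)ᶜ)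
  linarith

theorem risk_div_risk (θ : Params) {m : ℕ} (hm : 0 < m) (d d' : Rule m) :
    risk θ d / risk θ d' = relRisk θ d / relRisk θ d' := by
  have : (m : ℝ) * (θ.p * θ.deltaA) ≠ 0 := by
    have := θ.p_pos
    have := θ.deltaA_pos
    positivity
  rw [relRisk, relRisk, div_div_div_cancel_right₀ this]

/-! ### Asymptotic bounds for the errors of the BH rule -/

theorem tendsto_log_natCast {l : Filter ℕ} (hl : l ≤ atTop) :
    Tendsto (fun m : ℕ => Real.log m) l atTop :=
  (Real.tendsto_log_atTop.comp tendsto_natCast_atTop_atTop).mono_left hl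

theorem eventually_log_natCast_pos {l : Filter ℕ} (hl : l ≤ atTop) :
    ∀ᶠ m : ℕ in l, 0 < Real.log m :=
  (tendsto_log_natCast hl).eventually_gt_atTop 0

theorem tendsto_atBot_of_div {ι : Type*} {l : Filter ι} {X Y : ι → ℝ} {c : ℝ}
    (h : Tendsto (fun m => X m / Y m) l (𝓝 c)) (hc : c < 0) (hY : Tendsto Y l atTop) :
    Tendsto X l atBot := by
  refine (Tendsto.neg_mul_atTop hc h hY).congr' ?_
  filter_upwards [hY.eventually_gt_atTop 0] with m hm
  exact div_mul_cancel₀ _ hm.ne'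

/-- The type II error probability of the rule that rejects if `|X| / σ` is at least `c`. -/
noncomputable def missProb (θ : Params) (c : ℝ) : ℝ := 1 - normalTail (c / √(1 + θ.u))

theorem obsLaw_true_critSet_ge (θ : Params) {c t : ℝ} (hc : 0 ≤ c) (h : normalTail c ≤ t) :
    1 - missProb θ c ≤ (θ.obsLaw true).real (θ.critSet t) := by
  rw [missProb, sub_sub_cancel, ← θ.obsLaw_true_critSet_normalTail hc]
  exact measureReal_mono (θ.critSet_mono h)

theorem obsLaw_true_critSet_le (θ : Params) {c t : ℝ} (hc : 0 ≤ c) (h : t ≤ normalTail c) :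
    (θ.obsLaw true).real (θ.critSet t) ≤ 1 - missProb θ c := by
  rw [missProb, sub_sub_cancel, ← θ.obsLaw_true_critSet_normalTail hc]
  exact measureReal_mono (θ.critSet_mono h)

section

variable {γ : ℕ → Params} {l : Filter ℕ} {α L : ℝ}

theorem tendsto_log_f_div (hl : l ≤ atTop) (hp0 : Tendsto (fun m => (γ m).p) l (𝓝 0))
    (hL : Tendsto (fun m : ℕ => -Real.log (γ m).p / Real.log m) l (𝓝 L)) :
    Tendsto (fun m : ℕ => Real.log (γ m).f / Real.log m) l (𝓝 L) := by
  have h1 : Tendsto (fun m => Real.log (1 - (γ m).p)) l (𝓝 0) := by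
    have := (hp0.const_sub 1).log (by norm_num)
    simpa using this
  have h2 := (h1.div_atTop (tendsto_log_natCast hl)).add hL
  rw [zero_add] at h2
  refine h2.congr fun m => ?_
  rw [Params.f, Real.log_div (sub_pos.2 (γ m).p_lt_one).ne' (γ m).p_pos.ne']
  ring

/-- Up to vanishing probability the BH threshold is at most about `p m^g`, for a small `g > 0`. As
`p = m^{-L + o(1)}` and `κ / 2 < L`, this lies below the tail at `√(κ log m)`. -/
theorem eventually_le_typeIIError (hα₀ : 0 < α) (hα₁ : α < 1) (hl : l ≤ atTop) {a : ℝ}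
    (ha : 0 < a) (hpa : ∀ᶠ m : ℕ in l, a ≤ m * (γ m).p)
    (hL : Tendsto (fun m : ℕ => -Real.log (γ m).p / Real.log m) l (𝓝 L)) {κ : ℝ} (hκ₀ : 0 ≤ κ)
    (hκ : κ < 2 * L) {ε : ℝ} (hε : 0 < ε) :
    ∀ᶠ m : ℕ in l, ∀ i, missProb (γ m) √(κ * Real.log m) - ε ≤
      typeIIError (γ m) (benjaminiHochberg (γ m) α m) i := by
  obtain ⟨K, hK, hbound⟩ := exists_le_typeIIError hα₀ hα₁
  have hlog := tendsto_log_natCast hl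
  -- One `g` pays for inflating the threshold by `m^g`, another for the shift `c + 1` in
  -- `exp_le_normalTail`; the total exponent `-L + 2g + κ / 2 = -2g` stays negative.
  set g : ℝ := (L - κ / 2) / 4 with hg
  have hg0 : 0 < g := by rw [hg]; linarith
  have hpow : Tendsto (fun m : ℕ => Real.exp (g * Real.log m)) l atTop :=
    Real.tendsto_exp_atTop.comp (hlog.const_mul_atTop hg0)
  have hX : Tendsto (fun m : ℕ => Real.log 2 + Real.log √(2 * Real.pi) + 1 / 2 + Real.log (γ m).p +
      2 * (g * Real.log m) + κ / 2 * Real.log m) l atBot := by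
    refine tendsto_atBot_of_div (c := 0 - L + 2 * g + κ / 2) (Y := fun m : ℕ => Real.log m) ?_
      (by rw [hg]; linarith) hlog
    have h0 : Tendsto (fun m : ℕ => (Real.log 2 + Real.log √(2 * Real.pi) + 1 / 2) / Real.log m) l
        (𝓝 0) := tendsto_const_nhds.div_atTop hlog
    refine (((h0.sub hL).add_const (2 * g)).add_const (κ / 2)).congr' ?_
    filter_upwards [eventually_log_natCast_pos hl] with m hm
    field_simp
    ring
  filter_upwards [hpa, hpow.eventually_ge_atTop K, hpow.eventually_ge_atTop (K / (a * ε)),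
    hpow.eventually_ge_atTop (1 / a), hX.eventually_le_atBot 0, eventually_log_natCast_pos hl,
    hlog.eventually_ge_atTop (κ / g ^ 2)] with m h1 h2 h3 h4 h5 h6 h7 i
  have hm : (0 : ℝ) < m := by exact_mod_cast i.pos
  have hp := (γ m).p_pos
  set y := Real.log m with hy
  set E := Real.exp (g * y) with hE
  have hE0 : 0 < E := Real.exp_pos _
  set r₀ : ℕ := ⌈m * (γ m).p * E⌉₊ with hr₀
  have hprod : 0 < m * (γ m).p * E := by positivity
  have hr1 : m * (γ m).p * E ≤ r₀ := Nat.le_ceil _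
  have hr2 : (r₀ : ℝ) ≤ m * (γ m).p * E + 1 := (Nat.ceil_lt_add_one hprod.le).le
  have hr3 : 1 ≤ m * (γ m).p * E := by
    calc (1 : ℝ) = a * (1 / a) := by field_simp
      _ ≤ _ := by gcongr
  have h := hbound (γ m) m i r₀ (Nat.ceil_pos.2 hprod) (by
    refine le_trans ?_ hr1
    rw [mul_comm]
    gcongr)
  have hKr : K / r₀ ≤ ε := by
    rw [div_le_iff₀ (hprod.trans_le hr1)]
    have : K / (a * ε) * (a * ε) ≤ E * (a * ε) := by gcongr
    rw [div_mul_cancel₀ _ (by positivity)] at this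
    calc K ≤ ε * (a * E) := by linarith
      _ ≤ ε * r₀ := by
        gcongr
        exact le_trans (by gcongr) hr1
  have hcrit : r₀ * α / m ≤ normalTail √(κ * y) := by
    refine le_trans ?_ (exp_le_normalTail (Real.sqrt_nonneg _))
    have hb1 : r₀ * α / m ≤ 2 * (γ m).p * E := by
      rw [div_le_iff₀ hm]
      have : (r₀ : ℝ) * α ≤ r₀ * 1 := by gcongr
      nlinarith
    refine hb1.trans ?_
    have hsq : √(κ * y) ≤ g * y := by
      refine Real.sqrt_le_iff.2 ⟨by positivity, ?_⟩
      rw [div_le_iff₀ (by positivity)] at h7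
      nlinarith
    have hsq2 : √(κ * y) ^ 2 = κ * y := Real.sq_sqrt (by positivity)
    rw [← div_eq_inv_mul, le_div_iff₀ (by positivity)]
    have hl2 : 2 * (γ m).p * E * √(2 * Real.pi) =
        Real.exp (Real.log 2 + Real.log √(2 * Real.pi) + Real.log (γ m).p + g * y) := by
      rw [Real.exp_add, Real.exp_add, Real.exp_add, Real.exp_log two_pos, Real.exp_log
        (by positivity), Real.exp_log hp]
      ring
    rw [hl2]
    apply Real.exp_le_exp.2
    nlinarith
  have := obsLaw_true_critSet_le (γ m) (Real.sqrt_nonneg _) hcrit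
  linarith

/-- The cut `X² / σ² ≥ 4 log m` is already stricter than p-value `α / m`, and rescaling by `1 + u ≥
w log m` keeps it bounded under the alternative. -/
theorem exists_detection_lower_bound (hα₀ : 0 < α) (hl : l ≤ atTop) {w : ℝ} (hw : 0 < w)
    (hu : ∀ᶠ m : ℕ in l, w * Real.log m ≤ (γ m).u) :
    ∃ q : ℝ, 0 < q ∧ ∀ᶠ m : ℕ in l, q ≤ ((γ m).obsLaw true).real ((γ m).critSet (α / m)) := by
  refine ⟨normalTail √(4 / w), normalTail_pos _, ?_⟩
  have hm : ∀ᶠ m : ℕ in l, 2 / α ≤ m :=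
    (tendsto_natCast_atTop_atTop.mono_left hl).eventually_ge_atTop _
  filter_upwards [hu, eventually_log_natCast_pos hl, hm] with m h1 h2 h3
  have hm0 : (0 : ℝ) < m := lt_of_lt_of_le (by positivity) h3
  have htail : normalTail √(4 * Real.log m) ≤ α / m := by
    refine (normalTail_le_exp (Real.sqrt_nonneg _)).trans ?_
    rw [Real.sq_sqrt (by positivity)]
    have : Real.exp (-(4 * Real.log m) / 2) = ((m : ℝ) * m)⁻¹ := by
      rw [show -(4 * Real.log m) / 2 = -(Real.log m + Real.log m) by ring, Real.exp_neg,
        Real.exp_add, Real.exp_log hm0]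
    rw [this, le_div_iff₀ hm0, mul_inv]
    rw [div_le_iff₀ hα₀] at h3
    field_simp
    linarith
  refine le_trans ?_ (obsLaw_true_critSet_ge (γ m) (Real.sqrt_nonneg _) htail)
  rw [missProb, sub_sub_cancel]
  apply normalTail_antitone
  have hu0 := (γ m).u_pos
  rw [← Real.sqrt_div (by positivity)]
  apply Real.sqrt_le_sqrt
  rw [div_le_div_iff₀ (by linarith) hw]
  nlinarith

theorem exists_le_typeIError (hα₀ : 0 < α) (hα₁ : α < 1) (hl : l ≤ atTop) {w : ℝ} (hw : 0 < w)
    (hu : ∀ᶠ m : ℕ in l, w * Real.log m ≤ (γ m).u) :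
    ∃ c : ℝ, 0 < c ∧ ∀ᶠ m : ℕ in l, ∀ i, c * (γ m).p ≤
      typeIError (γ m) (benjaminiHochberg (γ m) α m) i := by
  obtain ⟨q, hq, hqm⟩ := exists_detection_lower_bound hα₀ hl hw hu
  have he : Real.exp (-(1 * q / 8)) < 1 := Real.exp_lt_one_iff.2 (by linarith)
  refine ⟨(1 - Real.exp (-(1 * q / 8))) * (α * min (1 / 1) (q / 8)), ?_, ?_⟩
  · have : 0 < min (1 / 1) (q / 8) := lt_min (by norm_num) (by positivity)
    have := sub_pos.2 he
    positivity
  · filter_upwards [hqm, hl (eventually_ge_atTop 2)] with m h1 h2 i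
    refine le_trans ?_ (le_typeIError hα₀ hα₁ (γ m) h2 i one_pos)
    rw [mul_assoc]
    have hp := (γ m).p_pos
    have : 0 ≤ min (1 / 1) (q / 8) := le_min (by norm_num) (by positivity)
    gcongr
    · have : Real.exp (-(1 * ((γ m).obsLaw true).real ((γ m).critSet (α / m)) / 8)) ≤
        Real.exp (-(1 * q / 8)) := by gcongr
      linarith

/-- With `M` large the exceptional probability is at most `ε`, at the price of a smaller constant
`c₀` in the threshold `c₀ p`. The constant is harmless, since `κ / 2 > L` leaves a power of `m` to
spare. -/
theorem eventually_typeIIError_le (hα₀ : 0 < α) (hl : l ≤ atTop) {w : ℝ} (hw : 0 < w)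
    (hu : ∀ᶠ m : ℕ in l, w * Real.log m ≤ (γ m).u)
    (hL : Tendsto (fun m : ℕ => -Real.log (γ m).p / Real.log m) l (𝓝 L)) (hL0 : 0 ≤ L) {κ : ℝ}
    (hκ : 2 * L < κ) {ε : ℝ} (hε : 0 < ε) :
    ∀ᶠ m : ℕ in l, ∀ i, typeIIError (γ m) (benjaminiHochberg (γ m) α m) i ≤
      missProb (γ m) √(κ * Real.log m) + ε := by
  obtain ⟨q, hq, hqm⟩ := exists_detection_lower_bound hα₀ hl hw hu
  have hlog := tendsto_log_natCast hl
  obtain ⟨M, hM, hMε⟩ : ∃ M : ℝ, 0 < M ∧ Real.exp (-(M * q / 8)) ≤ ε := by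
    refine ⟨max 1 (-(8 / q) * Real.log ε), by positivity, ?_⟩
    rw [← Real.le_log_iff_exp_le hε]
    have : -(8 / q) * Real.log ε ≤ max 1 (-(8 / q) * Real.log ε) := le_max_right _ _
    have h2 : -(8 / q) * Real.log ε * q ≤ max 1 (-(8 / q) * Real.log ε) * q := by gcongr
    have h3 : -(8 / q) * Real.log ε * q = -8 * Real.log ε := by field_simp
    linarith
  set c₀ : ℝ := α * min (1 / M) (q / 8) with hc₀
  have hc₀pos : 0 < c₀ := mul_pos hα₀ (lt_min (by positivity) (by positivity))
  have hX : Tendsto (fun m : ℕ => Real.log 2 - Real.log c₀ - Real.log (γ m).p -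
      κ / 2 * Real.log m) l atBot := by
    refine tendsto_atBot_of_div (c := 0 + L - κ / 2) (Y := fun m : ℕ => Real.log m) ?_
      (by linarith) hlog
    have h0 : Tendsto (fun m : ℕ => (Real.log 2 - Real.log c₀) / Real.log m) l
        (𝓝 0) := tendsto_const_nhds.div_atTop hlog
    refine ((h0.add hL).sub_const (κ / 2)).congr' ?_
    filter_upwards [eventually_log_natCast_pos hl] with m hm
    field_simp
    ring
  filter_upwards [hqm, hl (eventually_ge_atTop 2), hX.eventually_le_atBot 0,
    eventually_log_natCast_pos hl] with m h1 h2 h3 h4 i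
  have hp := (γ m).p_pos
  have h := typeIIError_le hα₀ (γ m) h2 i hM
  set Q := ((γ m).obsLaw true).real ((γ m).critSet (α / m)) with hQ
  have hexp : Real.exp (-(M * Q / 8)) ≤ ε := le_trans (by gcongr) hMε
  have hcrit : normalTail √(κ * Real.log m) ≤ α * min (1 / M) (Q / 8) * (γ m).p := by
    have hκ0 : 0 ≤ κ := by linarith
    calc normalTail √(κ * Real.log m) ≤ 2 * Real.exp (-√(κ * Real.log m) ^ 2 / 2) :=
          normalTail_le_exp (Real.sqrt_nonneg _)
      _ = Real.exp (Real.log 2 - κ / 2 * Real.log m) := by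
          rw [Real.sq_sqrt (by positivity), Real.exp_sub, Real.exp_log two_pos, neg_div,
            Real.exp_neg, div_eq_mul_inv]
          congr 3; ring
      _ ≤ Real.exp (Real.log c₀ + Real.log (γ m).p) := Real.exp_le_exp.2 (by linarith)
      _ = c₀ * (γ m).p := by rw [Real.exp_add, Real.exp_log hc₀pos, Real.exp_log hp]
      _ ≤ _ := by rw [hc₀]; gcongr
  have := obsLaw_true_critSet_ge (γ m) (Real.sqrt_nonneg _) hcrit
  linarith

theorem f_mul_p (θ : Params) : θ.f * θ.p = 1 - θ.p := div_mul_cancel₀ _ θ.p_pos.ne'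

theorem le_relRisk (θ : Params) {m : ℕ} (hm : 0 < m) (d : Rule m) {A : ℝ}
    (h : ∀ i, A ≤ θ.f * θ.delta * typeIError θ d i + typeIIError θ d i) : A ≤ relRisk θ d := by
  have hm0 : (0 : ℝ) < m := by exact_mod_cast hm
  rw [relRisk_eq, le_div_iff₀ hm0, mul_comm]
  have := Finset.sum_le_sum fun (i : Fin m) (_ : i ∈ Finset.univ) => h i
  simpa using this

theorem relRisk_le (θ : Params) {m : ℕ} (hm : 0 < m) (d : Rule m) {A : ℝ}
    (h : ∀ i, θ.f * θ.delta * typeIError θ d i + typeIIError θ d i ≤ A) : relRisk θ d ≤ A := by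
  have hm0 : (0 : ℝ) < m := by exact_mod_cast hm
  rw [relRisk_eq, div_le_iff₀ hm0]
  exact (Finset.sum_le_sum fun i _ => h i).trans (by simp [mul_comm])

theorem typeIError_nonneg (θ : Params) {m : ℕ} (d : Rule m) (i : Fin m) : 0 ≤ typeIError θ d i :=
  measureReal_nonneg

theorem typeIIError_nonneg (θ : Params) {m : ℕ} (d : Rule m) (i : Fin m) :
    0 ≤ typeIIError θ d i :=
  measureReal_nonneg

/-- The normalized risk of the BH rule is at least a multiple of `δ` plus any lower bound of the
type II error probabilities. -/
theorem exists_le_relRisk_benjaminiHochberg (hα₀ : 0 < α) (hα₁ : α < 1) (hl : l ≤ atTop)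
    (hp0 : Tendsto (fun m => (γ m).p) l (𝓝 0)) {w : ℝ} (hw : 0 < w)
    (hu : ∀ᶠ m : ℕ in l, w * Real.log m ≤ (γ m).u) :
    ∃ c : ℝ, 0 < c ∧ ∀ᶠ m : ℕ in l, ∀ A : ℝ,
      (∀ i, A ≤ typeIIError (γ m) (benjaminiHochberg (γ m) α m) i) →
      c * (γ m).delta + A ≤ relRisk (γ m) (benjaminiHochberg (γ m) α m) := by
  obtain ⟨c, hc, hcm⟩ := exists_le_typeIError hα₀ hα₁ hl hw hu
  refine ⟨c / 2, by positivity, ?_⟩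
  filter_upwards [hcm, hl (eventually_gt_atTop 0), hp0.eventually_le_const
    (show (0 : ℝ) < 1 / 2 by norm_num)] with m h1 h2 h3 A hA
  refine le_relRisk _ h2 _ fun i => add_le_add ?_ (hA i)
  have hf := (γ m).f_pos
  have hδ := (γ m).delta_pos
  calc c / 2 * (γ m).delta ≤ (1 - (γ m).p) * ((γ m).delta * c) := by
        have : 0 < (γ m).delta * c := by positivity
        nlinarith
    _ = (γ m).f * (γ m).delta * (c * (γ m).p) := by rw [← f_mul_p]; ring
    _ ≤ _ := by
        have := h1 i
        gcongr

/-- The normalized risk of the BH rule is at most a multiple of `δ` plus any upper bound of the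
type II error probabilities. -/
theorem exists_relRisk_benjaminiHochberg_le (hα₀ : 0 < α) (hα₁ : α < 1) (hl : l ≤ atTop) {a : ℝ}
    (ha : 0 < a) (hpa : ∀ᶠ m : ℕ in l, a ≤ m * (γ m).p) :
    ∃ c : ℝ, 0 < c ∧ ∀ᶠ m : ℕ in l, ∀ A : ℝ,
      (∀ i, typeIIError (γ m) (benjaminiHochberg (γ m) α m) i ≤ A) →
      relRisk (γ m) (benjaminiHochberg (γ m) α m) ≤ c * (γ m).delta + A := by
  obtain ⟨K, hK, hKm⟩ := exists_typeIError_le hα₀ hα₁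
  refine ⟨K * (1 + 1 / a), by positivity, ?_⟩
  filter_upwards [hpa, hl (eventually_gt_atTop 0)] with m h1 h2 A hA
  refine relRisk_le _ h2 _ fun i => add_le_add ?_ (hA i)
  have hf := (γ m).f_pos
  have hδ := (γ m).delta_pos
  have hp := (γ m).p_pos
  have hm0 : (0 : ℝ) < m := by exact_mod_cast h2
  have h3 : 1 / (m : ℝ) ≤ (γ m).p * (1 / a) := by
    rw [mul_one_div, div_le_div_iff₀ hm0 ha]
    linarith
  calc (γ m).f * (γ m).delta * typeIError (γ m) (benjaminiHochberg (γ m) α m) i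
      ≤ (γ m).f * (γ m).delta * (K * ((γ m).p + (γ m).p * (1 / a))) := by
        have := (hKm (γ m) m i)
        have h4 : K * ((γ m).p + 1 / m) ≤ K * ((γ m).p + (γ m).p * (1 / a)) := by gcongr
        have h5 := this.trans h4
        gcongr
    _ = ((γ m).f * (γ m).p) * (K * (1 + 1 / a) * (γ m).delta) := by ring
    _ ≤ 1 * (K * (1 + 1 / a) * (γ m).delta) := by
        rw [f_mul_p]
        gcongr
        linarith
    _ = _ := one_mul _

end

/-! ### Limits of the normalized risks -/

/-- The limit of the type II error probability of the threshold `X² / σ² ≥ κ log m` if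
`u / log m → w`. -/
noncomputable def limitMiss (w κ : ℝ) : ℝ := 1 - normalTail √(κ / w)

theorem limitMiss_strictMonoOn {w : ℝ} (hw : 0 < w) : StrictMonoOn (limitMiss w) (Set.Ici 0) := by
  intro a ha b hb hab
  refine sub_lt_sub_left (normalTail_strictAntiOn (Real.sqrt_nonneg _) (Real.sqrt_nonneg _) ?_) _
  exact Real.sqrt_lt_sqrt (div_nonneg ha hw.le) (by gcongr)

theorem limitMiss_pos {w κ : ℝ} (hw : 0 < w) (hκ : 0 < κ) : 0 < limitMiss w κ :=
  sub_pos.2 (normalTail_lt_one (Real.sqrt_pos.2 (by positivity)))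

theorem continuous_limitMiss (w : ℝ) : Continuous (limitMiss w) :=
  continuous_const.sub (continuousOn_normalTail.comp_continuous (by fun_prop)
    fun _ => Real.sqrt_nonneg _)

theorem exists_lt_limitMiss (w : ℝ) {K e : ℝ} (hK : 0 < K) (he : 0 < e) :
    ∃ κ, 0 < κ ∧ κ < K ∧ limitMiss w K - e < limitMiss w κ := by
  have h1 : ∀ᶠ κ in 𝓝[<] K, limitMiss w K - e < limitMiss w κ :=
    ((continuous_limitMiss w).tendsto K).mono_left nhdsWithin_le_nhds |>.eventually_const_lt
      (by linarith)
  obtain ⟨κ, h2, h3⟩ := (h1.and (Ioo_mem_nhdsLT hK)).exists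
  exact ⟨κ, h3.1, h3.2, h2⟩

theorem exists_limitMiss_lt (w : ℝ) {K e : ℝ} (he : 0 < e) :
    ∃ κ, K < κ ∧ limitMiss w κ < limitMiss w K + e := by
  have h1 : ∀ᶠ κ in 𝓝[>] K, limitMiss w κ < limitMiss w K + e :=
    ((continuous_limitMiss w).tendsto K).mono_left nhdsWithin_le_nhds |>.eventually_lt_const
      (by linarith)
  obtain ⟨κ, h2, h3⟩ := (h1.and self_mem_nhdsWithin).exists
  exact ⟨κ, h3, h2⟩

section

variable {γ : ℕ → Params} {l : Filter ℕ} {α L w : ℝ}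

theorem tendsto_missProb (hl : l ≤ atTop) (hw : 0 < w)
    (huw : Tendsto (fun m : ℕ => (γ m).u / Real.log m) l (𝓝 w)) {κ : ℝ} (hκ : 0 ≤ κ) :
    Tendsto (fun m : ℕ => missProb (γ m) √(κ * Real.log m)) l (𝓝 (limitMiss w κ)) := by
  have hlog := tendsto_log_natCast hl
  have h1 : Tendsto (fun m : ℕ => κ / ((Real.log m)⁻¹ + (γ m).u / Real.log m)) l (𝓝 (κ / w)) := by
    have := (hlog.inv_tendsto_atTop.add huw)
    rw [zero_add] at this
    exact tendsto_const_nhds.div this hw.ne'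
  have h2 := (((continuousOn_normalTail.comp_continuous Real.continuous_sqrt
    fun _ => Real.sqrt_nonneg _).tendsto (κ / w)).comp h1).const_sub 1
  refine h2.congr' ?_
  filter_upwards [eventually_log_natCast_pos hl] with m hm
  simp only [Function.comp, missProb]
  rw [← Real.sqrt_div (by positivity)]
  congr 3
  have := (γ m).u_pos
  field_simp

theorem eventually_mul_log_le_u (hl : l ≤ atTop) (hw : 0 < w)
    (huw : Tendsto (fun m : ℕ => (γ m).u / Real.log m) l (𝓝 w)) :
    ∀ᶠ m : ℕ in l, w / 2 * Real.log m ≤ (γ m).u := by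
  filter_upwards [huw.eventually_const_le (half_lt_self hw), eventually_log_natCast_pos hl]
    with m h1 h2
  rwa [le_div_iff₀ h2] at h1

theorem eventually_limitMiss_sub_le (hα₀ : 0 < α) (hα₁ : α < 1) (hl : l ≤ atTop) {a : ℝ}
    (ha : 0 < a) (hpa : ∀ᶠ m : ℕ in l, a ≤ m * (γ m).p)
    (hL : Tendsto (fun m : ℕ => -Real.log (γ m).p / Real.log m) l (𝓝 L)) (hL0 : 0 < L)
    (hw : 0 < w) (huw : Tendsto (fun m : ℕ => (γ m).u / Real.log m) l (𝓝 w))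
    {e : ℝ} (he : 0 < e) :
    ∀ᶠ m : ℕ in l, ∀ i, limitMiss w (2 * L) - e ≤
      typeIIError (γ m) (benjaminiHochberg (γ m) α m) i := by
  obtain ⟨κ, hκ0, hκ, hκe⟩ := exists_lt_limitMiss w (show 0 < 2 * L by positivity) (half_pos he)
  filter_upwards [eventually_le_typeIIError hα₀ hα₁ hl ha hpa hL hκ0.le hκ (half_pos he),
    (tendsto_missProb hl hw huw hκ0.le).eventually_const_le hκe] with m h1 h2 i
  linarith [h1 i]

theorem eventually_typeIIError_le_limitMiss_add (hα₀ : 0 < α) (hl : l ≤ atTop)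
    (hL : Tendsto (fun m : ℕ => -Real.log (γ m).p / Real.log m) l (𝓝 L)) (hL0 : 0 < L)
    (hw : 0 < w) (huw : Tendsto (fun m : ℕ => (γ m).u / Real.log m) l (𝓝 w))
    {e : ℝ} (he : 0 < e) :
    ∀ᶠ m : ℕ in l, ∀ i, typeIIError (γ m) (benjaminiHochberg (γ m) α m) i ≤
      limitMiss w (2 * L) + e := by
  obtain ⟨κ, hκ, hκe⟩ := exists_limitMiss_lt w (K := 2 * L) (half_pos he)
  filter_upwards [eventually_typeIIError_le hα₀ hl (half_pos hw)
      (eventually_mul_log_le_u hl hw huw) hL hL0.le hκ (half_pos he),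
    (tendsto_missProb hl hw huw (show 0 ≤ κ by linarith)).eventually_le_const hκe] with m h1 h2 i
  linarith [h1 i]

/-- The oracle is no worse than the fixed cut at `c m`, whose type I cost is at most `2 exp (log f +
log δ - c² / 2)`. -/
theorem eventually_relRisk_bayesOracle_le (hl : l ≤ atTop) {c : ℕ → ℝ} (hc : ∀ m, 0 ≤ c m)
    (h : Tendsto (fun m => Real.log (γ m).f + Real.log (γ m).delta - c m ^ 2 / 2) l atBot)
    {e : ℝ} (he : 0 < e) :
    ∀ᶠ m in l, relRisk (γ m) (bayesOracle (γ m) m) ≤ missProb (γ m) (c m) + e := by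
  filter_upwards [(Real.tendsto_exp_atBot.comp h).eventually_le_const (half_pos he),
    hl (eventually_gt_atTop 0)] with m h1 h2
  refine (relRisk_bayesOracle_le_threshold (γ m) h2 (c m)).trans ?_
  have hf := (γ m).f_pos
  have hδ := (γ m).delta_pos
  have h3 : (γ m).f * (γ m).delta * normalTail (c m) ≤ e := by
    calc (γ m).f * (γ m).delta * normalTail (c m)
        ≤ (γ m).f * (γ m).delta * (2 * Real.exp (-c m ^ 2 / 2)) := by
          gcongr; exact normalTail_le_exp (hc m)
      _ = 2 * Real.exp (Real.log (γ m).f + Real.log (γ m).delta - c m ^ 2 / 2) := by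
          rw [Real.exp_sub, Real.exp_add, Real.exp_log hf, Real.exp_log hδ, neg_div, Real.exp_neg]
          ring
      _ ≤ e := by
          simp only [Function.comp] at h1
          linarith
  rw [missProb]
  linarith

theorem tendsto_relRisk_bayesOracle (hl : l ≤ atTop)
    (hf : Tendsto (fun m : ℕ => Real.log (γ m).f / Real.log m) l (𝓝 L)) (hL0 : 0 < L)
    (hw : 0 < w) (huw : Tendsto (fun m : ℕ => (γ m).u / Real.log m) l (𝓝 w))
    (hδ : Tendsto (fun m : ℕ => Real.log (γ m).delta / Real.log m) l (𝓝 0)) :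
    Tendsto (fun m => relRisk (γ m) (bayesOracle (γ m) m)) l (𝓝 (limitMiss w (2 * L))) := by
  have hlog := tendsto_log_natCast hl
  have hsum := hf.add hδ
  rw [add_zero] at hsum
  rw [tendsto_order]
  constructor
  · intro b hb
    obtain ⟨κ, hκ0, hκ, hκe⟩ := exists_lt_limitMiss w (show 0 < 2 * L by positivity)
      (sub_pos.2 hb)
    rw [sub_sub_cancel] at hκe
    filter_upwards [(tendsto_missProb hl hw huw hκ0.le).eventually_const_lt hκe,
      hsum.eventually_const_le (show κ / 2 < L by linarith), eventually_log_natCast_pos hl,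
      hl (eventually_gt_atTop 0)] with m h1 h2 h3 h4
    refine h1.trans_le (le_relRisk_bayesOracle (γ m) h4 (Real.sqrt_nonneg _) ?_)
    rw [Real.sq_sqrt (by positivity)]
    rw [← add_div, le_div_iff₀ h3] at h2
    linarith
  · intro b hb
    obtain ⟨κ, hκ, hκe⟩ := exists_limitMiss_lt w (K := 2 * L) (half_pos (sub_pos.2 hb))
    have hκ0 : 0 ≤ κ := by linarith
    have hX : Tendsto (fun m : ℕ => Real.log (γ m).f + Real.log (γ m).delta -
        √(κ * Real.log m) ^ 2 / 2) l atBot := by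
      refine tendsto_atBot_of_div (c := L - κ / 2) (Y := fun m : ℕ => Real.log m) ?_
        (by linarith) hlog
      refine (hsum.sub_const (κ / 2)).congr' ?_
      filter_upwards [eventually_log_natCast_pos hl] with m hm
      rw [Real.sq_sqrt (by positivity)]
      field_simp
    filter_upwards [(tendsto_missProb hl hw huw hκ0).eventually_lt_const hκe,
      eventually_relRisk_bayesOracle_le hl (fun m => Real.sqrt_nonneg _) hX
        (half_pos (sub_pos.2 hb))] with m h1 h2
    linarith

theorem tendsto_relRisk_benjaminiHochberg (hα₀ : 0 < α) (hα₁ : α < 1) (hl : l ≤ atTop) {a : ℝ}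
    (ha : 0 < a) (hpa : ∀ᶠ m : ℕ in l, a ≤ m * (γ m).p)
    (hL : Tendsto (fun m : ℕ => -Real.log (γ m).p / Real.log m) l (𝓝 L)) (hL0 : 0 < L)
    (hw : 0 < w) (huw : Tendsto (fun m : ℕ => (γ m).u / Real.log m) l (𝓝 w))
    (hδ : Tendsto (fun m => (γ m).delta) l (𝓝 0)) :
    Tendsto (fun m => relRisk (γ m) (benjaminiHochberg (γ m) α m)) l
      (𝓝 (limitMiss w (2 * L))) := by
  obtain ⟨c, hc, hcm⟩ := exists_relRisk_benjaminiHochberg_le hα₀ hα₁ hl ha hpa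
  rw [tendsto_order]
  constructor
  · intro b hb
    filter_upwards [eventually_limitMiss_sub_le hα₀ hα₁ hl ha hpa hL hL0 hw huw
      (half_pos (sub_pos.2 hb)), hl (eventually_gt_atTop 0)] with m h1 h2
    refine lt_of_lt_of_le ?_ (le_relRisk _ h2 _ fun i => (h1 i).trans ?_)
    · linarith
    · have := mul_nonneg (mul_pos (γ m).f_pos (γ m).delta_pos).le
        (typeIError_nonneg (γ m) (benjaminiHochberg (γ m) α m) i)
      linarith
  · intro b hb
    have hcδ := hδ.const_mul c
    rw [mul_zero] at hcδ
    filter_upwards [eventually_typeIIError_le_limitMiss_add hα₀ hl hL hL0 hw huw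
      (half_pos (sub_pos.2 hb)), hcm, hcδ.eventually_lt_const (half_pos (sub_pos.2 hb))]
      with m h1 h2 h3
    have := h2 _ h1
    linarith

/-- If the normalized risk of the BH rule eventually exceeds the one of the oracle by a positive
constant, then the ratio of the risks does not tend to one. -/
theorem not_tendsto_risk_ratio [l.NeBot] (hl : l ≤ atTop) {β : ℝ} (hβ : 0 < β)
    (h : ∀ᶠ m in l, relRisk (γ m) (bayesOracle (γ m) m) + β ≤
      relRisk (γ m) (benjaminiHochberg (γ m) α m)) :
    ¬ Tendsto (fun m => risk (γ m) (benjaminiHochberg (γ m) α m) /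
      risk (γ m) (bayesOracle (γ m) m)) l (𝓝 1) := by
  intro ht
  have hpos : ∀ᶠ m in l, 0 < m := hl (eventually_gt_atTop 0)
  obtain ⟨m, h1, h2, h3, h4⟩ := (h.and (hpos.and
    ((ht.eventually_const_lt (show (0 : ℝ) < 1 by norm_num)).and
    (ht.eventually_lt_const (show (1 : ℝ) < 1 + β by linarith))))).exists
  rw [risk_div_risk (γ m) h2] at h3 h4
  set x := relRisk (γ m) (bayesOracle (γ m) m) with hx
  have hx1 : x ≤ 1 := relRisk_bayesOracle_le_one (γ m) h2
  -- A vanishing oracle risk would make the quotient 0 by the convention `y / 0 = 0`, contrary to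
  -- its being positive. With `x ≤ 1`, a ratio below `1 + β` then contradicts the additive gap.
  have hx0 : 0 < x := by
    refine lt_of_le_of_ne (relRisk_bayesOracle_nonneg (γ m) h2) fun h0 => ?_
    rw [← h0, div_zero] at h3
    exact lt_irrefl _ h3
  rw [div_lt_iff₀ hx0] at h4
  nlinarith

end

/-! ### Signal strength under the two detectability conditions -/

theorem log_v (θ : Params) :
    Real.log θ.v = Real.log θ.u + 2 * (Real.log θ.f + Real.log θ.delta) := by
  have hu := θ.u_pos
  have hf := θ.f_pos
  have hδ := θ.delta_pos
  rw [Params.v, Real.log_mul (by positivity) (by positivity),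
    Real.log_mul (by positivity) (by positivity), Real.log_pow, Real.log_pow]
  push_cast
  ring

section

variable {γ : ℕ → Params} {l : Filter ℕ} {α L w : ℝ}

theorem tendsto_log_f_add_log_delta_div_u {C : ℝ} (hu : Tendsto (fun m => (γ m).u) l atTop)
    (hC : Tendsto (fun m => Real.log (γ m).v / (γ m).u) l (𝓝 C)) :
    Tendsto (fun m => (Real.log (γ m).f + Real.log (γ m).delta) / (γ m).u) l (𝓝 (C / 2)) := by
  have h1 : Tendsto (fun m => Real.log (γ m).u / (γ m).u) l (𝓝 0) :=
    (Real.isLittleO_log_id_atTop.tendsto_div_nhds_zero).comp hu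
  have h2 := (hC.sub h1).div_const 2
  rw [sub_zero] at h2
  refine h2.congr fun m => ?_
  rw [log_v]
  ring

/-- On the verge of detectability `log (f δ) / u → C / 2`, because `log u` is negligible against
`u`. As `log (f δ) / log m → L`, dividing gives `w = 2L / C`. -/
theorem exists_tendsto_u_div_log (hl : l ≤ atTop)
    (hsignal : VergeOfDetectability γ ∨ LogarithmicSignals γ)
    (hf : Tendsto (fun m : ℕ => Real.log (γ m).f / Real.log m) l (𝓝 L)) (hL0 : 0 < L)
    (hδ : Tendsto (fun m : ℕ => Real.log (γ m).delta / Real.log m) l (𝓝 0)) :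
    ∃ w : ℝ, 0 < w ∧ Tendsto (fun m : ℕ => (γ m).u / Real.log m) l (𝓝 w) := by
  rcases hsignal with ⟨C, hC, -, hu, -, hvC⟩ | ⟨w, hw, huw⟩
  · have h1 := tendsto_log_f_add_log_delta_div_u (hu.mono_left hl) (hvC.mono_left hl)
    have h2 := hf.add hδ
    rw [add_zero] at h2
    refine ⟨L / (C / 2), by positivity, (h2.div h1 (by positivity)).congr' ?_⟩
    filter_upwards [h2.eventually_const_lt hL0, eventually_log_natCast_pos hl] with m h3 h4
    rw [← add_div] at h3
    simp only [Pi.div_apply, ← add_div]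
    have h5 : 0 < Real.log (γ m).f + Real.log (γ m).delta := by
      have := mul_pos h3 h4
      rwa [div_mul_cancel₀ _ h4.ne'] at this
    have := (γ m).u_pos
    field_simp
  · exact ⟨w, hw, huw.mono_left hl⟩

/-- If `δ` stays away from zero, then `u` is at least of order `log m`. -/
theorem exists_mul_log_le_u (hl : l ≤ atTop)
    (hsignal : VergeOfDetectability γ ∨ LogarithmicSignals γ)
    (hf : Tendsto (fun m : ℕ => Real.log (γ m).f / Real.log m) l (𝓝 L)) (hL0 : 0 < L)
    (hδ : ∀ᶠ m in l, 1 ≤ (γ m).delta) :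
    ∃ w : ℝ, 0 < w ∧ ∀ᶠ m : ℕ in l, w * Real.log m ≤ (γ m).u := by
  rcases hsignal with ⟨C, hC, -, hu, -, hvC⟩ | ⟨w, hw, huw⟩
  · have h1 := tendsto_log_f_add_log_delta_div_u (hu.mono_left hl) (hvC.mono_left hl)
    refine ⟨L / 2 / C, by positivity, ?_⟩
    filter_upwards [h1.eventually_le_const (half_lt_self hC),
      hf.eventually_const_le (half_lt_self hL0), eventually_log_natCast_pos hl, hδ]
      with m h2 h3 h4 h5
    have := (γ m).u_pos
    rw [div_le_iff₀ this] at h2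
    rw [le_div_iff₀ h4] at h3
    have := Real.log_nonneg h5
    rw [div_mul_eq_mul_div, div_le_iff₀ hC]
    linarith
  · exact ⟨w / 2, by positivity, eventually_mul_log_le_u hl hw (huw.mono_left hl)⟩

/-! ### Necessity of the two conditions on `δ` -/

/-- For bounded `δ`, oracle and BH share the type II limit, but BH pays at least `c ε` more for type
I errors. For unbounded `δ` the BH cost `c δ` alone exceeds the oracle's bound 1. -/
theorem not_optimal_of_le_delta (U : Ultrafilter ℕ) (hU : (U : Filter ℕ) ≤ atTop) (hα₀ : 0 < α)
    (hα₁ : α < 1) (hsignal : VergeOfDetectability γ ∨ LogarithmicSignals γ) {a : ℝ} (ha : 0 < a)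
    (hpa : ∀ᶠ m : ℕ in U, a ≤ m * (γ m).p) (hp0 : Tendsto (fun m => (γ m).p) U (𝓝 0))
    (hL : Tendsto (fun m : ℕ => -Real.log (γ m).p / Real.log m) U (𝓝 L)) (hL0 : 0 < L)
    {ε : ℝ} (hε : 0 < ε) (hδ : ∀ᶠ m in U, ε ≤ (γ m).delta) :
    ¬ AsymptoticallyOptimal γ (fun m => benjaminiHochberg (γ m) α m) := by
  have hf := tendsto_log_f_div hU hp0 hL
  intro hopt
  by_cases hbdd : ∃ M, ∀ᶠ m in U, (γ m).delta ≤ M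
  · obtain ⟨M, hM⟩ := hbdd
    have hδ0 : Tendsto (fun m : ℕ => Real.log (γ m).delta / Real.log m) U (𝓝 0) := by
      have hlog := tendsto_log_natCast hU
      refine tendsto_of_tendsto_of_tendsto_of_le_of_le' (tendsto_const_nhds.div_atTop hlog)
        (tendsto_const_nhds.div_atTop hlog) (g := fun m : ℕ => Real.log ε / Real.log m)
        (h := fun m : ℕ => Real.log M / Real.log m) ?_ ?_
      · filter_upwards [hδ, eventually_log_natCast_pos hU] with m h1 h2
        gcongr
      · filter_upwards [hM, eventually_log_natCast_pos hU] with m h1 h2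
        have := (γ m).delta_pos
        gcongr
    obtain ⟨w, hw, huw⟩ := exists_tendsto_u_div_log hU hsignal hf hL0 hδ0
    obtain ⟨c, hc, hcm⟩ := exists_le_relRisk_benjaminiHochberg hα₀ hα₁ hU hp0 (half_pos hw)
      (eventually_mul_log_le_u hU hw huw)
    -- One third for each of the two approximations, leaving one third as the gap.
    have he : 0 < c * ε / 3 := by positivity
    refine not_tendsto_risk_ratio (γ := γ) (α := α) hU he ?_ (hopt.mono_left hU)
    filter_upwards [hcm, eventually_limitMiss_sub_le hα₀ hα₁ hU ha hpa hL hL0 hw huw he,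
      (tendsto_relRisk_bayesOracle hU hf hL0 hw huw hδ0).eventually_le_const
        (lt_add_of_pos_right _ he), hδ] with m h1 h2 h3 h4
    have h5 := h1 _ h2
    have h6 : c * ε ≤ c * (γ m).delta := by gcongr
    linarith
  · have hδ' : ∀ M, ∀ᶠ m in U, M ≤ (γ m).delta := fun M => by
      have : ¬ ∀ᶠ m in U, (γ m).delta ≤ M := fun h => hbdd ⟨M, h⟩
      rw [← Ultrafilter.eventually_not] at this
      filter_upwards [this] with m hm
      exact (not_le.1 hm).le
    obtain ⟨w, hw, huw⟩ := exists_mul_log_le_u hU hsignal hf hL0 (hδ' 1)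
    obtain ⟨c, hc, hcm⟩ := exists_le_relRisk_benjaminiHochberg hα₀ hα₁ hU hp0 hw huw
    refine not_tendsto_risk_ratio (γ := γ) (α := α) hU one_pos ?_ (hopt.mono_left hU)
    filter_upwards [hcm, hδ' (2 / c), hU (eventually_gt_atTop 0)] with m h1 h2 h3
    have h4 := h1 0 fun i => typeIIError_nonneg _ _ _
    have h5 := relRisk_bayesOracle_le_one (γ m) h3
    rw [div_le_iff₀ hc] at h2
    linarith

/-- Here `log (f δ) ≤ (L - 3ε/4) log m`, whereas BH misses at least as much as the cut `(2L - ε/2)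
log m`, up to `o(1)`. A cut strictly between the two scales beats BH by a constant; on the verge of
detectability it is measured in units of `u`, otherwise in units of `log m`. -/
theorem not_optimal_of_log_delta_le (U : Ultrafilter ℕ) (hU : (U : Filter ℕ) ≤ atTop)
    (hα₀ : 0 < α) (hα₁ : α < 1) (hsignal : VergeOfDetectability γ ∨ LogarithmicSignals γ) {a : ℝ}
    (ha : 0 < a) (hpa : ∀ᶠ m : ℕ in U, a ≤ m * (γ m).p)
    (hp0 : Tendsto (fun m => (γ m).p) U (𝓝 0))
    (hL : Tendsto (fun m : ℕ => -Real.log (γ m).p / Real.log m) U (𝓝 L))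
    {ε : ℝ} (hε : 0 < ε) (hεL : ε ≤ L)
    (hδ : ∀ᶠ m : ℕ in U, Real.log (γ m).delta / Real.log m ≤ -ε) :
    ¬ AsymptoticallyOptimal γ (fun m => benjaminiHochberg (γ m) α m) := by
  have hf := tendsto_log_f_div hU hp0 hL
  have hlog := tendsto_log_natCast hU
  have hle : ∀ {e A : ℝ} {m : ℕ}, 0 < m → (∀ i, A - e ≤
      typeIIError (γ m) (benjaminiHochberg (γ m) α m) i) →
      A - e ≤ relRisk (γ m) (benjaminiHochberg (γ m) α m) := fun {e A m} hm h =>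
    le_relRisk _ hm _ fun i => by
      have := mul_nonneg (mul_pos (γ m).f_pos (γ m).delta_pos).le
        (typeIError_nonneg (γ m) (benjaminiHochberg (γ m) α m) i)
      linarith [h i]
  have hsum : ∀ᶠ m : ℕ in U, Real.log (γ m).f + Real.log (γ m).delta ≤
      (L - 3 / 4 * ε) * Real.log m := by
    filter_upwards [hδ, hf.eventually_le_const (show L < L + ε / 4 by linarith),
      eventually_log_natCast_pos hU] with m h1 h2 h3
    rw [div_le_iff₀ h3] at h1 h2
    linarith
  have hmiss : ∀ {e : ℝ}, 0 < e → ∀ᶠ m : ℕ in U, ∀ i,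
      missProb (γ m) √((2 * L - ε / 2) * Real.log m) - e ≤
      typeIIError (γ m) (benjaminiHochberg (γ m) α m) i := fun he =>
    eventually_le_typeIIError hα₀ hα₁ hU ha hpa hL (by linarith) (by linarith) he
  intro hopt
  rcases hsignal with ⟨C, hC, -, hu, -, hvC⟩ | ⟨w, hw, huw⟩
  · have hu' := hu.mono_left hU
    have h1 := tendsto_log_f_add_log_delta_div_u hu' (hvC.mono_left hU)
    -- The BH cut exceeds `2 log (f δ) ~ C u` by at least the factor `ρ`, asymptotically. Between
    -- `C` and `C (1 + ρ) / 2`, `C₁ u` is the competing cut and `C₂` separates it from BH, with room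
    -- to absorb the 1 in `1 + u`.
    set ρ : ℝ := (L - ε / 4) / (L - 3 / 4 * ε) with hρ
    have hden : 0 < L - 3 / 4 * ε := by linarith
    have hρ1 : 1 < ρ := by rw [hρ, one_lt_div hden]; linarith
    have hρeq : ρ * (L - 3 / 4 * ε) = L - ε / 4 := div_mul_cancel₀ _ hden.ne'
    obtain ⟨C₁, hC₁, hC₁ρ⟩ := exists_between (show C < C * (1 + ρ) / 2 by nlinarith)
    obtain ⟨C₂, hC₂, hC₂ρ⟩ := exists_between hC₁ρ
    have hX : Tendsto (fun m => Real.log (γ m).f + Real.log (γ m).delta -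
        √(C₁ * (γ m).u) ^ 2 / 2) U atBot := by
      refine tendsto_atBot_of_div (c := C / 2 - C₁ / 2) (Y := fun m => (γ m).u) ?_
        (by linarith) hu'
      refine (h1.sub_const (C₁ / 2)).congr fun m => ?_
      have := (γ m).u_pos
      rw [Real.sq_sqrt (by have := hC.trans hC₁; positivity)]
      field_simp
    have hβ : 0 < normalTail √C₁ - normalTail √C₂ := sub_pos.2 (normalTail_strictAntiOn
      (Real.sqrt_nonneg _) (Real.sqrt_nonneg _) (Real.sqrt_lt_sqrt (by linarith) hC₂))
    set β := normalTail √C₁ - normalTail √C₂ with hβdef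
    refine not_tendsto_risk_ratio (γ := γ) (α := α) hU (β := β / 3) (by positivity) ?_
      (hopt.mono_left hU)
    filter_upwards [eventually_relRisk_bayesOracle_le hU (fun m => Real.sqrt_nonneg _) hX
        (show 0 < β / 3 by positivity), hmiss (show 0 < β / 3 by positivity),
      hU (eventually_gt_atTop 0), hsum,
      h1.eventually_const_le (show C * (1 / ρ + 1) / 2 / 2 < C / 2 by
        have : 1 / ρ < 1 := (div_lt_one (by linarith)).2 hρ1
        nlinarith),
      hu'.eventually_ge_atTop (C₂ / (C * (1 + ρ) / 2 - C₂)), eventually_log_natCast_pos hU]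
      with m h2 h3 h4 h5 h6 h7 h8
    have hu0 := (γ m).u_pos
    have h9 := hle h4 h3
    have h10 : missProb (γ m) √(C₁ * (γ m).u) ≤ 1 - normalTail √C₁ := by
      refine sub_le_sub_left (normalTail_antitone ?_) _
      rw [← Real.sqrt_div (by have := hC.trans hC₁; positivity)]
      apply Real.sqrt_le_sqrt
      rw [div_le_iff₀ (by linarith)]
      nlinarith
    have h11 : 1 - normalTail √C₂ ≤ missProb (γ m) √((2 * L - ε / 2) * Real.log m) := by
      refine sub_le_sub_left (normalTail_antitone ?_) _
      rw [← Real.sqrt_div (mul_nonneg (by linarith) h8.le)]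
      apply Real.sqrt_le_sqrt
      rw [le_div_iff₀ (by linarith)]
      rw [le_div_iff₀ hu0] at h6
      rw [div_le_iff₀ (by linarith)] at h7
      have h12 : C * (1 / ρ + 1) / 2 / 2 * (γ m).u ≤ (L - 3 / 4 * ε) * Real.log m := h6.trans h5
      have h13 : ρ * (C * (1 / ρ + 1) / 2 / 2 * (γ m).u) ≤
          ρ * ((L - 3 / 4 * ε) * Real.log m) := by gcongr
      rw [← mul_assoc ρ (L - 3 / 4 * ε), hρeq] at h13
      have h14 : ρ * (C * (1 / ρ + 1) / 2 / 2 * (γ m).u) = C * (1 + ρ) / 2 * (γ m).u / 2 := by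
        have : ρ ≠ 0 := by linarith
        field_simp
      rw [h14] at h13
      linarith
    linarith
  · have huw' := huw.mono_left hU
    have hX : Tendsto (fun m : ℕ => Real.log (γ m).f + Real.log (γ m).delta -
        √((2 * L - ε) * Real.log m) ^ 2 / 2) U atBot := by
      refine tendsto_atBot_mono' (U : Filter ℕ) ?_
        ((tendsto_const_mul_atBot_of_neg (r := -(ε / 4)) (by linarith)).2 hlog)
      filter_upwards [hsum, eventually_log_natCast_pos hU] with m h1 h2
      rw [Real.sq_sqrt (mul_nonneg (by linarith) h2.le)]
      linarith
    have hκ : (0 : ℝ) ≤ 2 * L - ε := by linarith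
    have hκ' : (0 : ℝ) ≤ 2 * L - ε / 2 := by linarith
    have hβ := sub_pos.2 (limitMiss_strictMonoOn hw hκ hκ'
      (show 2 * L - ε < 2 * L - ε / 2 by linarith))
    set β := limitMiss w (2 * L - ε / 2) - limitMiss w (2 * L - ε) with hβdef
    -- Four approximation errors are subtracted from `β`, leaving `β / 5`.
    have he : 0 < β / 5 := by positivity
    refine not_tendsto_risk_ratio (γ := γ) (α := α) hU he ?_ (hopt.mono_left hU)
    filter_upwards [eventually_relRisk_bayesOracle_le hU (fun m => Real.sqrt_nonneg _) hX he,
      hmiss he, hU (eventually_gt_atTop 0),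
      (tendsto_missProb hU hw huw' hκ).eventually_le_const (lt_add_of_pos_right _ he),
      (tendsto_missProb hU hw huw' hκ').eventually_const_le (sub_lt_self _ he)]
      with m h1 h2 h3 h4 h5
    have h6 := hle h3 h2
    linarith

theorem exists_tendsto_neg_log_p_div (U : Ultrafilter ℕ) (hU : (U : Filter ℕ) ≤ atTop)
    {a₁ a₂ a₃ : ℝ} (ha₁ : 0 < a₁) (ha₂ : 0 < a₂) (ha₃ : 0 < a₃)
    (hp : ∀ m : ℕ, 1 ≤ m → a₁ * (m : ℝ)⁻¹ ≤ (γ m).p ∧ (γ m).p ≤ a₂ * (m : ℝ) ^ (-a₃)) :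
    ∃ L : ℝ, 0 < L ∧ Tendsto (fun m : ℕ => -Real.log (γ m).p / Real.log m) U (𝓝 L) := by
  have hlog := tendsto_log_natCast hU
  -- The limiting range is `[a₃, 1]`; the slack absorbs `log a₁` and `log a₂`, and compactness then
  -- yields a positive limit.
  have hmem : ∀ᶠ m : ℕ in U, -Real.log (γ m).p / Real.log m ∈ Set.Icc (a₃ / 2) 2 := by
    filter_upwards [hU (eventually_ge_atTop 1), eventually_log_natCast_pos hU,
      hlog.eventually_ge_atTop (-Real.log a₁), hlog.eventually_ge_atTop (2 / a₃ * Real.log a₂)]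
      with m h1 h2 h3 h4
    obtain ⟨h5, h6⟩ := hp m h1
    have hm : (0 : ℝ) < m := by exact_mod_cast h1
    have hp0 := (γ m).p_pos
    have h7 := Real.log_le_log (by positivity) h5
    have h8 := Real.log_le_log hp0 h6
    rw [Real.log_mul ha₁.ne' (by positivity), Real.log_inv] at h7
    rw [Real.log_mul ha₂.ne' (by positivity), Real.log_rpow hm] at h8
    have h9 : Real.log a₂ ≤ a₃ / 2 * Real.log m := by
      calc Real.log a₂ = a₃ / 2 * (2 / a₃ * Real.log a₂) := by field_simp
        _ ≤ _ := by gcongr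
    rw [Set.mem_Icc, le_div_iff₀ h2, div_le_iff₀ h2]
    constructor <;> linarith
  obtain ⟨L, hL, hUL⟩ := isCompact_iff_ultrafilter_le_nhds.1 (isCompact_Icc (a := a₃ / 2) (b := 2))
    (U.map fun m : ℕ => -Real.log (γ m).p / Real.log m) (le_principal_iff.2 hmem)
  exact ⟨L, lt_of_lt_of_le (by positivity) hL.1, hUL⟩

end

/-! ### The equivalence, assembled along ultrafilters -/

theorem asymptoticallyOptimal_benjaminiHochberg_iff (γ : ℕ → Params) (α a₁ a₂ a₃ : ℝ)
    (hα₀ : 0 < α) (hα₁ : α < 1) (ha₁ : 0 < a₁) (ha₂ : 0 < a₂) (ha₃ : 0 < a₃)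
    (hp : ∀ m : ℕ, 1 ≤ m → a₁ * (m : ℝ)⁻¹ ≤ (γ m).p ∧ (γ m).p ≤ a₂ * (m : ℝ) ^ (-a₃))
    (hsignal : VergeOfDetectability γ ∨ LogarithmicSignals γ) :
    AsymptoticallyOptimal γ
        (fun m => benjaminiHochberg (γ m) α m) ↔
      (Tendsto (fun m => (γ m).delta) atTop (𝓝 0) ∧
        Tendsto (fun m : ℕ => Real.log (γ m).delta / Real.log m) atTop (𝓝 0)) := by
  have hpa : ∀ᶠ m : ℕ in atTop, a₁ ≤ m * (γ m).p := by
    filter_upwards [eventually_ge_atTop 1] with m hm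
    have hm0 : (0 : ℝ) < m := by exact_mod_cast hm
    have := (hp m hm).1
    rw [← div_eq_mul_inv, div_le_iff₀ hm0] at this
    linarith
  have hp0 : Tendsto (fun m => (γ m).p) atTop (𝓝 0) := by
    have h1 : Tendsto (fun m : ℕ => a₂ * (m : ℝ) ^ (-a₃)) atTop (𝓝 0) := by
      have := ((tendsto_rpow_neg_atTop ha₃).comp tendsto_natCast_atTop_atTop).const_mul a₂
      rwa [mul_zero] at this
    refine squeeze_zero' (Eventually.of_forall fun m => (γ m).p_pos.le) ?_ h1
    filter_upwards [eventually_ge_atTop 1] with m hm using (hp m hm).2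
  constructor
  · intro hopt
    have key : ∀ U : Ultrafilter ℕ, (U : Filter ℕ) ≤ atTop →
        (∀ ε, 0 < ε → ∀ᶠ m in U, (γ m).delta < ε) ∧
        (∀ ε, 0 < ε → ∀ᶠ m : ℕ in U, -ε < Real.log (γ m).delta / Real.log m) := by
      intro U hU
      obtain ⟨L, hL0, hL⟩ := exists_tendsto_neg_log_p_div U hU ha₁ ha₂ ha₃ hp
      constructor
      · intro ε hε
        by_contra hcon
        rw [← Ultrafilter.eventually_not] at hcon
        exact not_optimal_of_le_delta U hU hα₀ hα₁ hsignal ha₁ (hU hpa) (hp0.mono_left hU) hL hL0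
          hε (hcon.mono fun m hm => not_lt.1 hm) hopt
      · intro ε hε
        by_contra hcon
        rw [← Ultrafilter.eventually_not] at hcon
        -- Replacing `ε` by `min ε L` keeps all comparison cuts nonnegative.
        refine not_optimal_of_log_delta_le U hU hα₀ hα₁ hsignal ha₁ (hU hpa) (hp0.mono_left hU) hL
          (lt_min hε hL0) (min_le_right _ _) (hcon.mono fun m hm => ?_) hopt
        exact (not_lt.1 hm).trans (neg_le_neg (min_le_left _ _))
    constructor
    · rw [tendsto_iff_ultrafilter]
      intro U hU
      rw [tendsto_order]
      exact ⟨fun b hb => Eventually.of_forall fun m => hb.trans (γ m).delta_pos,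
        fun b hb => (key U hU).1 b hb⟩
    · rw [tendsto_iff_ultrafilter]
      intro U hU
      rw [tendsto_order]
      constructor
      · intro b hb
        have := (key U hU).2 (-b) (by linarith)
        rwa [neg_neg] at this
      · intro b hb
        -- The upper half is free: once `δ < 1` the quotient is negative.
        filter_upwards [(key U hU).1 1 one_pos, eventually_log_natCast_pos hU] with m h1 h2
        exact (div_neg_of_neg_of_pos (Real.log_neg (γ m).delta_pos h1) h2).trans hb
  · rintro ⟨hδ, hlogδ⟩
    rw [AsymptoticallyOptimal, tendsto_iff_ultrafilter]
    intro U hU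
    obtain ⟨L, hL0, hL⟩ := exists_tendsto_neg_log_p_div U hU ha₁ ha₂ ha₃ hp
    have hf := tendsto_log_f_div hU (hp0.mono_left hU) hL
    obtain ⟨w, hw, huw⟩ := exists_tendsto_u_div_log hU hsignal hf hL0 (hlogδ.mono_left hU)
    have h1 := tendsto_relRisk_bayesOracle hU hf hL0 hw huw (hlogδ.mono_left hU)
    have h2 := tendsto_relRisk_benjaminiHochberg hα₀ hα₁ hU ha₁ (hU hpa) hL hL0 hw huw
      (hδ.mono_left hU)
    have hpos : limitMiss w (2 * L) ≠ 0 := (limitMiss_pos hw (by positivity)).ne'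
    have h3 := h2.div h1 hpos
    rw [div_self hpos] at h3
    refine h3.congr' ?_
    filter_upwards [hU (eventually_gt_atTop 0)] with m hm
    exact (risk_div_risk (γ m) hm _ _).symm

end ScaleMixture

theorem corollary6p1 (γ : ℕ → ScaleMixture.Params) (α a₁ a₂ a₃ : ℝ)
    (hα₀ : 0 < α) (hα₁ : α < 1) (ha₁ : 0 < a₁) (ha₂ : 0 < a₂) (ha₃ : 0 < a₃) (ha₃' : a₃ < 1)
    (hp : ∀ m : ℕ, 1 ≤ m → a₁ * (m : ℝ)⁻¹ ≤ (γ m).p ∧ (γ m).p ≤ a₂ * (m : ℝ) ^ (-a₃))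
    (hsignal : ScaleMixture.VergeOfDetectability γ ∨ ScaleMixture.LogarithmicSignals γ) :
    ScaleMixture.AsymptoticallyOptimal γ
        (fun m => ScaleMixture.benjaminiHochberg (γ m) α m) ↔
      (Tendsto (fun m => (γ m).delta) atTop (𝓝 0) ∧
        Tendsto (fun m : ℕ => Real.log (γ m).delta / Real.log m) atTop (𝓝 0)) := by
  exact ScaleMixture.asymptoticallyOptimal_benjaminiHochberg_iff γ α a₁ a₂ a₃ hα₀ hα₁ ha₁ ha₂ ha₃ hp
    hsignal
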